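/- Let $K$ be a field with $\operatorname{char} K\neq 2,3$, with algebraic closure $\overline K$, and let $n\in\{1,2,3,4\}$. Let $X_n$ be the affine space (of dimension $5,8,10,20$ respectively) of genus one models $\phi$ of degree $n$: for $n=1$, Weierstrass equations $y^2+a_1xy+a_3y=x^3+a_2x^2+a_4x+a_6$; for $n=2$, pairs $(p,q)$ of a binary quadratic and a binary quartic form, with equation $y^2+p(x,z)y=q(x,z)$ in $\mathbb P(1,1,2)$; for $n=3$, ternary cubic forms; for $n=4$, pairs $(q_1,q_2)$ of quadratic forms in four variables. A model $\phi$ over $\overline K$ defines a scheme $C_\phi$ in $\mathbb P^2$, $\mathbb P(1,1,2)$, $\mathbb P^2$, $\mathbb P^3$ respectively; $\phi$ is called singular if $C_\phi$ is not a smooth curve. Let $W$ be the affine space of Weierstrass forms $y^2=4x^3-g_2x-g_3$, with discriminant $\Delta_W=2^{12}(g_2^3-27g_3^2)\in K[W]=K[g_2,g_3]$, and let $\varphi_n:X_n\to W$ be the following polynomial map, $\varphi_n(\phi)=(g_2,g_3)$. To a quartic $ax^4+bx^3z+cx^2z^2+dxz^3+ez^4$ one attaches $(g_2,g_3)=(i,j)$,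 where $$i=\tfrac1{12}(12ae-3bd+c^2),\qquad j=\tfrac1{432}(72ace-27ad^2-27b^2e+9bcd-2c^3).$$ * $n=1$: $\varphi_1(\phi)=(c_4/12,\;c_6/216)$ with the usual $c_4,c_6$ of a Weierstrass equation (completing the square and the cube). * $n=2$: $\varphi_2(p,q)$ is attached to the quartic $\tfrac14p^2+q$. * $n=3$: $\varphi_3(\phi)=(-108\,S,\;27\,T)$, where $S,T$ are the classical Aronhold invariants, of degrees $4$ and $6$, of the ternary cubic $\phi=ax^3+by^3+cz^3+3a_2x^2y+3a_3x^2z+3b_1xy^2+3b_3y^2z+3c_1xz^2+3c_2yz^2+6mxyz$, normalised so that $S$ contains the term $abcm$, and $T$ the term $a^2b^2c^2$, with coefficient $1$. * $n=4$: $\varphi_4(q_1,q_2)$ is attached to the quartic $\det(xA+zB)$, where $A,B$ are the symmetric matrices of $q_1,q_2$. Let $\varphi_n^*:K[W]\to K[X_n]$ be the pullback of polynomials along $\varphi_n$. Call a polynomial $\Delta\in K[X_n]$ a discriminant of $X_n$ if it is geometrically irreducible (irreducible in $\overline K[X_n]$) and, for every model $\phi$ over $\overline K$, $\Delta(\phi)=0$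 if and only if $\phi$ is singular. Then $X_n$ has a discriminant, and for every discriminant $\Delta_{X_n}$ of $X_n$ there is a constant $c\in K^*$ such that $$\Delta_{X_n}=c\,\varphi_n^*(\Delta_W).$$ -/

import Mathlib

open MvPolynomial

noncomputable section

namespace GenusOne

/-! ## Genus one models of degree `n = 1, 2, 3, 4` -/

/-- Dimension of the affine space `X_n` of genus one models of degree `n`, for `n ≤ 4`
(`0` is a dummy value for the other `n`). -/
def modelDim : ℕ → ℕ
  | 1 => 5
  | 2 => 8
  | 3 => 10
  | 4 => 20
  | _ => 0

/-- A genus one model of degree `n` over `R`: a point of the affine space `X_n`, that is, the list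
of coefficients of the model. The coordinates are

* `n = 1`: `(a₁, a₂, a₃, a₄, a₆)`, see `weierstrassCurve`;
* `n = 2`: `(α₀, α₁, α₂, a, b, c, d, e)`, see `doubleCoverForm`;
* `n = 3`: `(a, b, c, a₂, a₃, b₁, b₃, c₁, c₂, m)`, see `cubicForm`;
* `n = 4`: the ten coefficients of `q₁`, then those of `q₂`, see `quadricForm`. -/
abbrev Model (n : ℕ) (R : Type*) : Type _ := Fin (modelDim n) → R

section Equations

variable {R : Type*} [CommRing R]

/-- Degree 1: the Weierstrass equation `y² + a₁xy + a₃y = x³ + a₂x² + a₄x + a₆`. -/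
def weierstrassCurve (φ : Fin 5 → R) : WeierstrassCurve R :=
  ⟨φ 0, φ 1, φ 2, φ 3, φ 4⟩

/-- Degree 2: `y² + (α₀x² + α₁xz + α₂z²)y - (ax⁴ + bx³z + cx²z² + dxz³ + ez⁴)`, where the
variables `0, 1, 2` are `x, z, y`, of weights `1, 1, 2`. -/
def doubleCoverForm (φ : Fin 8 → R) : MvPolynomial (Fin 3) R :=
  X 2 ^ 2 + (C (φ 0) * X 0 ^ 2 + C (φ 1) * X 0 * X 1 + C (φ 2) * X 1 ^ 2) * X 2
    - (C (φ 3) * X 0 ^ 4 + C (φ 4) * X 0 ^ 3 * X 1 + C (φ 5) * X 0 ^ 2 * X 1 ^ 2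
      + C (φ 6) * X 0 * X 1 ^ 3 + C (φ 7) * X 1 ^ 4)

/-- Degree 3: the ternary cubic
`ax³ + by³ + cz³ + a₂x²y + a₃x²z + b₁xy² + b₃y²z + c₁xz² + c₂yz² + mxyz`. -/
def cubicForm (φ : Fin 10 → R) : MvPolynomial (Fin 3) R :=
  C (φ 0) * X 0 ^ 3 + C (φ 1) * X 1 ^ 3 + C (φ 2) * X 2 ^ 3
    + C (φ 3) * X 0 ^ 2 * X 1 + C (φ 4) * X 0 ^ 2 * X 2
    + C (φ 5) * X 0 * X 1 ^ 2 + C (φ 6) * X 1 ^ 2 * X 2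
    + C (φ 7) * X 0 * X 2 ^ 2 + C (φ 8) * X 1 * X 2 ^ 2
    + C (φ 9) * X 0 * X 1 * X 2

/-- A quadratic form in four variables, from its coefficients at
`x₀², x₁², x₂², x₃², x₀x₁, x₀x₂, x₀x₃, x₁x₂, x₁x₃, x₂x₃`. -/
def quadricForm (q : Fin 10 → R) : MvPolynomial (Fin 4) R :=
  C (q 0) * X 0 ^ 2 + C (q 1) * X 1 ^ 2 + C (q 2) * X 2 ^ 2 + C (q 3) * X 3 ^ 2
    + C (q 4) * X 0 * X 1 + C (q 5) * X 0 * X 2 + C (q 6) * X 0 * X 3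
    + C (q 7) * X 1 * X 2 + C (q 8) * X 1 * X 3 + C (q 9) * X 2 * X 3

/-- Degree 4: the coefficients of the two quadrics of a model of degree 4. -/
def quadricPair (φ : Fin 20 → R) : Fin 2 → Fin 10 → R :=
  ![fun i => φ (Fin.castAdd 10 i), fun i => φ (Fin.natAdd 10 i)]

/-! ## Singular models -/

/-- `P` is a common zero of the polynomial `F` and of all its partial derivatives. -/
def IsSingularZero {σ : Type*} (F : MvPolynomial σ R) (P : σ → R) : Prop :=
  eval P F = 0 ∧ ∀ i, eval P (pderiv i F) = 0

end Equations

/-- The model `φ`, over an algebraically closed field `F`, is singular: the subscheme `C_φ` of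
`ℙ²` (`n = 1, 3`), of `ℙ(1,1,2)` (`n = 2`) or of `ℙ³` (`n = 4`) that it defines is not a smooth
curve. This is the Jacobian criterion. For `n = 2` the vertex `x = z = 0` of `ℙ(1,1,2)` never lies
on `C_φ`; for `n = 4` the criterion asks for a point of `C_φ` at which the gradients of the two
quadrics are linearly dependent. -/
def IsSingular {F : Type*} [Field F] : (n : ℕ) → Model n F → Prop
  | 1, φ => ∃ P : Fin 3 → F, P ≠ 0 ∧ IsSingularZero (weierstrassCurve φ).toProjective.polynomial P
  | 2, φ => ∃ P : Fin 3 → F, ¬(P 0 = 0 ∧ P 1 = 0) ∧ IsSingularZero (doubleCoverForm φ) P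
  | 3, φ => ∃ P : Fin 3 → F, P ≠ 0 ∧ IsSingularZero (cubicForm φ) P
  | 4, φ => ∃ P : Fin 4 → F, P ≠ 0 ∧ (∀ k, eval P (quadricForm (quadricPair φ k)) = 0) ∧
      ¬ LinearIndependent F
        (fun (k : Fin 2) (i : Fin 4) => eval P (pderiv i (quadricForm (quadricPair φ k))))
  | _, _ => False

/-- `Δ` is a discriminant of the space `X_n` over `K`: a geometrically irreducible polynomial in
the coefficients of the models that vanishes exactly at the singular ones (over the algebraic
closure of `K`). -/
structure IsDiscriminant (K : Type*) [Field K] (n : ℕ)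
    (Δ : MvPolynomial (Fin (modelDim n)) K) : Prop where
  irreducible : Irreducible (map (algebraMap K (AlgebraicClosure K)) Δ)
  eq_zero_iff : ∀ φ : Model n (AlgebraicClosure K), aeval φ Δ = 0 ↔ IsSingular n φ

/-! ## The map `φ_n` from models to Weierstrass forms `y² = 4x³ - g₂x - g₃`

Below, `K` is a field in which `2` and `3` are invertible, and `A` is a `K`-algebra in which the
coefficients of the models lie. -/

section WeierstrassMap

variable (K : Type*) [Field K] {A : Type*} [CommRing A] [Algebra K A]

/-- The classical invariant `i` of the quartic `ax⁴ + bx³z + cx²z² + dxz³ + ez⁴`. -/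
def quarticI (a b c d e : A) : A :=
  (12 : K)⁻¹ • (12 * a * e - 3 * b * d + c ^ 2)

/-- The classical invariant `j` of the quartic `ax⁴ + bx³z + cx²z² + dxz³ + ez⁴`. -/
def quarticJ (a b c d e : A) : A :=
  (432 : K)⁻¹ • (72 * a * c * e - 27 * a * d ^ 2 - 27 * b ^ 2 * e + 9 * b * c * d - 2 * c ^ 3)

/-- The Weierstrass form `y² = 4x³ - ix - j` attached to a quartic. -/
def quarticMap (a b c d e : A) : Fin 2 → A :=
  ![quarticI K a b c d e, quarticJ K a b c d e]

/-- Degree 1: completing the square and the cube, `g₂ = c₄ / 12` and `g₃ = c₆ / 216`. -/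
def weierstrassMap₁ (φ : Fin 5 → A) : Fin 2 → A :=
  ![(12 : K)⁻¹ • (weierstrassCurve φ).c₄, (216 : K)⁻¹ • (weierstrassCurve φ).c₆]

/-- Degree 2: completing the square turns the model `y² + py = q` into `y² = p² / 4 + q`. -/
def weierstrassMap₂ (φ : Fin 8 → A) : Fin 2 → A :=
  quarticMap K
    (φ 3 + (4 : K)⁻¹ • φ 0 ^ 2)
    (φ 4 + (4 : K)⁻¹ • (2 * φ 0 * φ 1))
    (φ 5 + (4 : K)⁻¹ • (φ 1 ^ 2 + 2 * φ 0 * φ 2))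
    (φ 6 + (4 : K)⁻¹ • (2 * φ 1 * φ 2))
    (φ 7 + (4 : K)⁻¹ • φ 2 ^ 2)

/-- The classical (Aronhold) invariant `S` of degree 4 of a ternary cubic, which is written
classically as `ax³ + by³ + cz³ + 3a₂x²y + 3a₃x²z + 3b₁xy² + 3b₃y²z + 3c₁xz² + 3c₂yz² + 6mxyz`. -/
def cubicS (φ : Fin 10 → A) : A :=
  let a := φ 0; let b := φ 1; let c := φ 2
  let a₂ := (3 : K)⁻¹ • φ 3; let a₃ := (3 : K)⁻¹ • φ 4
  let b₁ := (3 : K)⁻¹ • φ 5; let b₃ := (3 : K)⁻¹ • φ 6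
  let c₁ := (3 : K)⁻¹ • φ 7; let c₂ := (3 : K)⁻¹ • φ 8
  let m := (6 : K)⁻¹ • φ 9
  (
    a * b * c * m - a * b * c₁ * c₂ - a * c * b₁ * b₃ + a * b₁ * c₂ ^ 2 + a * b₃ ^ 2 * c₁
    - a * b₃ * c₂ * m - b * c * a₂ * a₃ + b * a₂ * c₁ ^ 2 + b * a₃ ^ 2 * c₂ - b * a₃ * c₁ * m
    + c * a₂ ^ 2 * b₃ - c * a₂ * b₁ * m + c * a₃ * b₁ ^ 2 - a₂ ^ 2 * c₂ ^ 2 + a₂ * a₃ * b₃ * c₂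
    + a₂ * b₁ * c₁ * c₂ - 3 * a₂ * b₃ * c₁ * m + 2 * a₂ * c₂ * m ^ 2 - a₃ ^ 2 * b₃ ^ 2
    + a₃ * b₁ * b₃ * c₁ - 3 * a₃ * b₁ * c₂ * m + 2 * a₃ * b₃ * m ^ 2 - b₁ ^ 2 * c₁ ^ 2
    + 2 * b₁ * c₁ * m ^ 2 - m ^ 4)

/-- The classical (Aronhold) invariant `T` of degree 6 of a ternary cubic, which is written
classically as `ax³ + by³ + cz³ + 3a₂x²y + 3a₃x²z + 3b₁xy² + 3b₃y²z + 3c₁xz² + 3c₂yz² + 6mxyz`. -/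
def cubicT (φ : Fin 10 → A) : A :=
  let a := φ 0; let b := φ 1; let c := φ 2
  let a₂ := (3 : K)⁻¹ • φ 3; let a₃ := (3 : K)⁻¹ • φ 4
  let b₁ := (3 : K)⁻¹ • φ 5; let b₃ := (3 : K)⁻¹ • φ 6
  let c₁ := (3 : K)⁻¹ • φ 7; let c₂ := (3 : K)⁻¹ • φ 8
  let m := (6 : K)⁻¹ • φ 9
  (
    a ^ 2 * b ^ 2 * c ^ 2 - 6 * a ^ 2 * b * c * b₃ * c₂ + 4 * a ^ 2 * b * c₂ ^ 3
    + 4 * a ^ 2 * c * b₃ ^ 3 - 3 * a ^ 2 * b₃ ^ 2 * c₂ ^ 2 - 6 * a * b ^ 2 * c * a₃ * c₁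
    + 4 * a * b ^ 2 * c₁ ^ 3 - 6 * a * b * c ^ 2 * a₂ * b₁ + 6 * a * b * c * a₂ * b₃ * c₁
    + 12 * a * b * c * a₂ * c₂ * m + 6 * a * b * c * a₃ * b₁ * c₂ + 12 * a * b * c * a₃ * b₃ * m
    + 12 * a * b * c * b₁ * c₁ * m - 20 * a * b * c * m ^ 3 - 12 * a * b * a₂ * c₁ * c₂ ^ 2
    + 18 * a * b * a₃ * b₃ * c₁ * c₂ - 24 * a * b * a₃ * c₂ ^ 2 * m
    - 12 * a * b * b₁ * c₁ ^ 2 * c₂ - 24 * a * b * b₃ * c₁ ^ 2 * m + 36 * a * b * c₁ * c₂ * m ^ 2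
    + 4 * a * c ^ 2 * b₁ ^ 3 + 18 * a * c * a₂ * b₁ * b₃ * c₂ - 24 * a * c * a₂ * b₃ ^ 2 * m
    - 12 * a * c * a₃ * b₁ * b₃ ^ 2 - 12 * a * c * b₁ ^ 2 * b₃ * c₁
    - 24 * a * c * b₁ ^ 2 * c₂ * m + 36 * a * c * b₁ * b₃ * m ^ 2 - 12 * a * a₂ * b₁ * c₂ ^ 3
    + 6 * a * a₂ * b₃ ^ 2 * c₁ * c₂ + 12 * a * a₂ * b₃ * c₂ ^ 2 * m
    + 6 * a * a₃ * b₁ * b₃ * c₂ ^ 2 - 12 * a * a₃ * b₃ ^ 3 * c₁ + 12 * a * a₃ * b₃ ^ 2 * c₂ * m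
    + 24 * a * b₁ ^ 2 * c₁ * c₂ ^ 2 + 24 * a * b₁ * b₃ ^ 2 * c₁ ^ 2
    - 60 * a * b₁ * b₃ * c₁ * c₂ * m + 12 * a * b₁ * c₂ ^ 2 * m ^ 2
    + 12 * a * b₃ ^ 2 * c₁ * m ^ 2 - 12 * a * b₃ * c₂ * m ^ 3 + 4 * b ^ 2 * c * a₃ ^ 3
    - 3 * b ^ 2 * a₃ ^ 2 * c₁ ^ 2 + 4 * b * c ^ 2 * a₂ ^ 3 - 12 * b * c * a₂ ^ 2 * a₃ * c₂
    - 24 * b * c * a₂ ^ 2 * c₁ * m - 12 * b * c * a₂ * a₃ ^ 2 * b₃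
    + 18 * b * c * a₂ * a₃ * b₁ * c₁ + 36 * b * c * a₂ * a₃ * m ^ 2
    - 24 * b * c * a₃ ^ 2 * b₁ * m + 24 * b * a₂ ^ 2 * c₁ ^ 2 * c₂
    + 24 * b * a₂ * a₃ ^ 2 * c₂ ^ 2 + 6 * b * a₂ * a₃ * b₃ * c₁ ^ 2
    - 60 * b * a₂ * a₃ * c₁ * c₂ * m - 12 * b * a₂ * b₁ * c₁ ^ 3 + 12 * b * a₂ * c₁ ^ 2 * m ^ 2
    - 12 * b * a₃ ^ 3 * b₃ * c₂ + 6 * b * a₃ ^ 2 * b₁ * c₁ * c₂ + 12 * b * a₃ ^ 2 * b₃ * c₁ * m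
    + 12 * b * a₃ ^ 2 * c₂ * m ^ 2 + 12 * b * a₃ * b₁ * c₁ ^ 2 * m - 12 * b * a₃ * c₁ * m ^ 3
    - 3 * c ^ 2 * a₂ ^ 2 * b₁ ^ 2 - 12 * c * a₂ ^ 3 * b₃ * c₂ + 24 * c * a₂ ^ 2 * a₃ * b₃ ^ 2
    + 6 * c * a₂ ^ 2 * b₁ * b₃ * c₁ + 12 * c * a₂ ^ 2 * b₁ * c₂ * m
    + 12 * c * a₂ ^ 2 * b₃ * m ^ 2 + 6 * c * a₂ * a₃ * b₁ ^ 2 * c₂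
    - 60 * c * a₂ * a₃ * b₁ * b₃ * m + 12 * c * a₂ * b₁ ^ 2 * c₁ * m - 12 * c * a₂ * b₁ * m ^ 3
    + 24 * c * a₃ ^ 2 * b₁ ^ 2 * b₃ - 12 * c * a₃ * b₁ ^ 3 * c₁ + 12 * c * a₃ * b₁ ^ 2 * m ^ 2
    + 8 * a₂ ^ 3 * c₂ ^ 3 - 12 * a₂ ^ 2 * a₃ * b₃ * c₂ ^ 2 - 12 * a₂ ^ 2 * b₁ * c₁ * c₂ ^ 2
    - 27 * a₂ ^ 2 * b₃ ^ 2 * c₁ ^ 2 + 36 * a₂ ^ 2 * b₃ * c₁ * c₂ * m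
    - 24 * a₂ ^ 2 * c₂ ^ 2 * m ^ 2 - 12 * a₂ * a₃ ^ 2 * b₃ ^ 2 * c₂
    - 6 * a₂ * a₃ * b₁ * b₃ * c₁ * c₂ + 36 * a₂ * a₃ * b₁ * c₂ ^ 2 * m
    + 36 * a₂ * a₃ * b₃ ^ 2 * c₁ * m - 12 * a₂ * a₃ * b₃ * c₂ * m ^ 2
    - 12 * a₂ * b₁ ^ 2 * c₁ ^ 2 * c₂ + 36 * a₂ * b₁ * b₃ * c₁ ^ 2 * m
    - 12 * a₂ * b₁ * c₁ * c₂ * m ^ 2 - 36 * a₂ * b₃ * c₁ * m ^ 3 + 24 * a₂ * c₂ * m ^ 4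
    + 8 * a₃ ^ 3 * b₃ ^ 3 - 27 * a₃ ^ 2 * b₁ ^ 2 * c₂ ^ 2 - 12 * a₃ ^ 2 * b₁ * b₃ ^ 2 * c₁
    + 36 * a₃ ^ 2 * b₁ * b₃ * c₂ * m - 24 * a₃ ^ 2 * b₃ ^ 2 * m ^ 2
    - 12 * a₃ * b₁ ^ 2 * b₃ * c₁ ^ 2 + 36 * a₃ * b₁ ^ 2 * c₁ * c₂ * m
    - 12 * a₃ * b₁ * b₃ * c₁ * m ^ 2 - 36 * a₃ * b₁ * c₂ * m ^ 3 + 24 * a₃ * b₃ * m ^ 4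
    + 8 * b₁ ^ 3 * c₁ ^ 3 - 24 * b₁ ^ 2 * c₁ ^ 2 * m ^ 2 + 24 * b₁ * c₁ * m ^ 4 - 8 * m ^ 6)

/-- Degree 3: the Weierstrass form `y² = 4x³ + 108Sx - 27T`. -/
def weierstrassMap₃ (φ : Fin 10 → A) : Fin 2 → A :=
  ![-108 * cubicS K φ, 27 * cubicT K φ]

/-- The symmetric matrix `M` with `x M xᵀ` the quadratic form with coefficients `q`. -/
def quadricMatrix (q : Fin 10 → A) : Matrix (Fin 4) (Fin 4) A :=
  let h : Fin 10 → A := fun i => (2 : K)⁻¹ • q i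
  !![q 0, h 4, h 5, h 6;
     h 4, q 1, h 7, h 8;
     h 5, h 7, q 2, h 9;
     h 6, h 8, h 9, q 3]

/-- The polynomial `det(xA + B)`, for the matrices `A`, `B` of the two quadrics. -/
def pencilDet (φ : Fin 20 → A) : Polynomial A :=
  ((Polynomial.X : Polynomial A) • (quadricMatrix K (quadricPair φ 0)).map Polynomial.C
    + (quadricMatrix K (quadricPair φ 1)).map Polynomial.C).det

/-- Degree 4: the Weierstrass form attached to the quartic
`det(xA + zB) = ax⁴ + bx³z + cx²z² + dxz³ + ez⁴`. -/
def weierstrassMap₄ (φ : Fin 20 → A) : Fin 2 → A :=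
  quarticMap K ((pencilDet K φ).coeff 4) ((pencilDet K φ).coeff 3) ((pencilDet K φ).coeff 2)
    ((pencilDet K φ).coeff 1) ((pencilDet K φ).coeff 0)

/-- The map `φ_n : X_n → W`, `φ ↦ (g₂, g₃)`. -/
def weierstrassMap : (n : ℕ) → Model n A → Fin 2 → A
  | 1, φ => weierstrassMap₁ K φ
  | 2, φ => weierstrassMap₂ K φ
  | 3, φ => weierstrassMap₃ K φ
  | 4, φ => weierstrassMap₄ K φ
  | _, _ => 0

end WeierstrassMap

/-- The discriminant `Δ_W = 2¹² (g₂³ - 27 g₃²)` of the space `W` of Weierstrass forms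
`y² = 4x³ - g₂x - g₃`, as an element of `K[W] = K[g₂, g₃]`. It is `(c₄³ - c₆²) / 1728`, where
`c₄ = 2⁶ 3 g₂` and `c₆ = 2⁹ 3³ g₃`. -/
def weierstrassDisc (K : Type*) [Field K] : MvPolynomial (Fin 2) K :=
  2 ^ 12 * (X 0 ^ 3 - 27 * X 1 ^ 2)

/-- The pullback `φ_n^* : K[W] → K[X_n]` along the map `φ_n`, which is substitution of the two
components of `φ_n`, computed for the generic model, in a polynomial in `g₂, g₃`. -/
def pullback (K : Type*) [Field K] (n : ℕ) :
    MvPolynomial (Fin 2) K →ₐ[K] MvPolynomial (Fin (modelDim n)) K :=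
  aeval (weierstrassMap K n (X : Model n (MvPolynomial (Fin (modelDim n)) K)))

end GenusOne

end

/-!
Write `D = φ_n^*(Δ_W)`; up to a constant its value at a model is `g₂³ - 27g₃²`. The theorem follows
from three properties of `D` over an algebraically closed field in which `2` and `3` are nonzero.

* `D` vanishes exactly at the singular models.
* The singular models are the image of an affine space under a polynomial map: choose a point `P`
  and an equation that is singular at `P`. By the Nullstellensatz `D` is then a power of an
  irreducible polynomial, up to a constant.
* `D` has a simple zero at `t = 0` on a one-parameter family of models, essentially
  `y² = (x + 1)(x² - t)`. So the power is the first power, and `D` is irreducible.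

The algebra behind the last two points is `MvPolynomial.irreducible_of_zeroLocus_eq_range`, and
`isDiscriminant_pullback` is the resulting criterion. Two discriminants have the same zeros, so by
the Nullstellensatz again they divide each other over the algebraic closure, and the constant lies
in `K` because the coefficients do (`MvPolynomial.exists_eq_C_mul_of_zeroLocus_eq`).

The first point reduces to binary quartics: `quarticDisc`, which is `g₂³ - 27g₃²` up to a constant,
vanishes if and only if the quartic has a multiple zero (`quarticDisc_eq_zero_iff`). To prove this
the linear factors of the quartic are split off one by one. The quartics are the following.

* For `n = 1, 2` complete the square; for `n = 1` the quartic is a cubic with a zero at infinity.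
* For `n = 3` the invariants `S` and `T` are unchanged by the coordinate changes needed to move a
  point of the cubic to `(0 : 0 : 1)`. The equation becomes `z²L + zQ + C`, and projection from the
  point gives the quartic `Q² - 4LC`, whose invariants are those of the cubic
  (`quarticDisc_projection`).
* For `n = 4` the quartic is `det(xA + zB)`. If `M` is a degenerate member of the pencil, `P` is in
  its kernel, and `N` is another member, then the derivative of the determinant at `M` in the
  direction of `N` is `tr(adj(M) N)`, which is proportional to `Pᵀ N P`
  (`Matrix.sq_mul_coeff_one_det`). So a multiple zero gives either a member singular at a point of
  the other quadrics, or a member of corank at least two, whose vertex meets them; and conversely.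
-/

/-! ### Irreducibility and uniqueness of a polynomial with a given zero locus -/

/-- Over an algebraically closed field, a polynomial that vanishes at all zeros of `f` has a power
divisible by `f`. -/
theorem MvPolynomial.exists_dvd_pow_of_eval_eq_zero {F σ : Type*} [Field F] [IsAlgClosed F]
    [Finite σ] {f g : MvPolynomial σ F} (h : ∀ x, eval x f = 0 → eval x g = 0) :
    ∃ k : ℕ, f ∣ g ^ k := by
  have hg : g ∈ vanishingIdeal F (zeroLocus F (Ideal.span {f})) := by
    rw [mem_vanishingIdeal_iff]
    intro x hx
    rw [mem_zeroLocus_iff] at hx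
    have := hx f (Ideal.mem_span_singleton_self f)
    rw [aeval_eq_eval] at this ⊢
    exact h x this
  rw [vanishingIdeal_zeroLocus_eq_radical] at hg
  obtain ⟨k, hk⟩ := hg
  exact ⟨k, Ideal.mem_span_singleton.mp hk⟩

/-- Over an algebraically closed field, a polynomial `D` is irreducible if its zero locus is the
image of an affine space under a polynomial map `ψ` and `D` has a simple zero on some parametrized
curve `l`. By the Nullstellensatz, the first condition makes `D` a power of an irreducible
polynomial, and the second makes the exponent `1`. -/
theorem MvPolynomial.irreducible_of_zeroLocus_eq_range {F σ τ : Type*} [Field F] [IsAlgClosed F]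
    [Finite σ] (D : MvPolynomial σ F) (ψ : σ → MvPolynomial τ F)
    (hψ : ∀ x, eval x D = 0 ↔ ∃ t : τ → F, ∀ i, eval t (ψ i) = x i)
    (l : σ → Polynomial F) (u : Polynomial F) (hl : aeval l D = Polynomial.X * u)
    (hu : u.eval 0 ≠ 0) : Irreducible D := by
  have hD0 : D ≠ 0 := by
    rintro rfl
    have : Polynomial.X * u = 0 := by rw [← hl, map_zero]
    rcases mul_eq_zero.mp this with h | h
    · exact Polynomial.X_ne_zero h
    · simp [h] at hu
  -- The polynomials that vanish on the image of `ψ` form a prime ideal.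
  have hprime : (RingHom.ker (aeval ψ : MvPolynomial σ F →ₐ[F] MvPolynomial τ F)).IsPrime :=
    RingHom.ker_isPrime _
  have heval : ∀ (t : τ → F) (f : MvPolynomial σ F),
      eval t (aeval ψ f) = eval (fun i => eval t (ψ i)) f := by
    intro t f
    induction f using MvPolynomial.induction_on with
    | C a => simp
    | add p q hp hq => rw [map_add, map_add, map_add, hp, hq]
    | mul_X p i hp => rw [map_mul, map_mul, map_mul, hp, aeval_X, eval_X]
  have hDker : D ∈ RingHom.ker (aeval ψ : MvPolynomial σ F →ₐ[F] MvPolynomial τ F) := by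
    rw [RingHom.mem_ker]
    refine MvPolynomial.funext fun t => ?_
    rw [heval, map_zero]
    exact (hψ _).mpr ⟨t, fun _ => rfl⟩
  obtain ⟨p, hpD, hp, hpker⟩ : ∃ p, p ∣ D ∧ Prime p ∧
      p ∈ RingHom.ker (aeval ψ : MvPolynomial σ F →ₐ[F] MvPolynomial τ F) := by
    obtain ⟨w, hw⟩ := UniqueFactorizationMonoid.factors_prod hD0
    have h1 : (UniqueFactorizationMonoid.factors D).prod ∈
        RingHom.ker (aeval ψ : MvPolynomial σ F →ₐ[F] MvPolynomial τ F) := by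
      rw [← hw] at hDker
      exact (hprime.mem_or_mem hDker).resolve_right fun h =>
        hprime.ne_top (Ideal.eq_top_of_isUnit_mem _ h w.isUnit)
    obtain ⟨p, hp1, hp2⟩ := (hprime.multiset_prod_mem_iff_exists_mem _).mp h1
    exact ⟨p, UniqueFactorizationMonoid.dvd_of_mem_factors hp1,
      UniqueFactorizationMonoid.prime_of_factor _ hp1, hp2⟩
  have hpvan : ∀ x, eval x D = 0 → eval x p = 0 := by
    intro x hx
    obtain ⟨t, ht⟩ := (hψ x).mp hx
    rw [RingHom.mem_ker] at hpker
    have := heval t p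
    rw [hpker, map_zero, _root_.funext ht] at this
    exact this.symm
  obtain ⟨k, hk⟩ := exists_dvd_pow_of_eval_eq_zero hpvan
  obtain ⟨c, rfl⟩ := hpD
  have hc0 : c ≠ 0 := right_ne_zero_of_mul hD0
  suffices hc : IsUnit c from
    (associated_mul_unit_right p c hc).irreducible hp.irreducible
  by_contra hc
  obtain ⟨q, hq, hqc⟩ := WfDvdMonoid.exists_irreducible_factor hc hc0
  have hqp : q ∣ p := (UniqueFactorizationMonoid.irreducible_iff_prime.mp hq).dvd_of_dvd_pow
    ((hqc.trans (Dvd.intro_left p rfl)).trans hk)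
  have hpc : p ∣ c := ((hq.dvd_symm hp.irreducible) hqp).trans hqc
  have hX : ∀ f : MvPolynomial σ F, Polynomial.X ∣ aeval l f ↔
      eval (fun i => (l i).eval 0) f = 0 := by
    intro f
    rw [Polynomial.X_dvd_iff, Polynomial.coeff_zero_eq_eval_zero]
    refine Eq.congr_left ?_
    induction f using MvPolynomial.induction_on with
    | C a => simp
    | add p q hp hq => simp [hp, hq]
    | mul_X p i hp => simp [hp]
  have h1 : Polynomial.X ∣ aeval l p := (hX p).mpr (hpvan _ ((hX _).mp (hl ▸ Dvd.intro u rfl)))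
  have h2 : Polynomial.X ∣ aeval l c := h1.trans (map_dvd (aeval l) hpc)
  have h3 : Polynomial.X * Polynomial.X ∣ Polynomial.X * u := by
    rw [← hl, map_mul]
    exact mul_dvd_mul h1 h2
  have h4 := (mul_dvd_mul_iff_left Polynomial.X_ne_zero).mp h3
  rw [Polynomial.X_dvd_iff, Polynomial.coeff_zero_eq_eval_zero] at h4
  exact hu h4

/-- Two polynomials over `K` that are irreducible over an algebraically closed extension `F` and
have the same zeros over `F` differ by a constant of `K`. -/
theorem MvPolynomial.exists_eq_C_mul_of_zeroLocus_eq {K F σ : Type*} [Field K] [Field F]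
    [IsAlgClosed F] [Algebra K F] [Finite σ] {f g : MvPolynomial σ K}
    (hf : Irreducible (map (algebraMap K F) f)) (hg : Irreducible (map (algebraMap K F) g))
    (h : ∀ x : σ → F, aeval x g = 0 → aeval x f = 0) :
    ∃ c : K, c ≠ 0 ∧ f = C c * g := by
  have h' : ∀ x, eval x (map (algebraMap K F) g) = 0 → eval x (map (algebraMap K F) f) = 0 := by
    intro x hx
    rw [eval_map, ← aeval_def] at hx ⊢
    exact h x hx
  obtain ⟨k, hk⟩ := exists_dvd_pow_of_eval_eq_zero h'
  have hgf := (UniqueFactorizationMonoid.irreducible_iff_prime.mp hg).dvd_of_dvd_pow hk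
  obtain ⟨w, hw⟩ := hgf
  obtain ⟨r, hr, rfl⟩ := isUnit_iff_eq_C_of_isReduced.mp
    ((hf.isUnit_or_isUnit hw).resolve_left hg.not_isUnit)
  have hg0 : g ≠ 0 := by
    rintro rfl
    exact hg.ne_zero (map_zero _)
  have hf0 : f ≠ 0 := by
    rintro rfl
    exact hf.ne_zero (map_zero _)
  -- Comparing a nonzero coefficient of `g` shows that the constant `r` lies in `K`.
  obtain ⟨m, hm⟩ := exists_coeff_ne_zero hg0
  have hcoeff : algebraMap K F (coeff m f) = algebraMap K F (coeff m g) * r := by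
    rw [← coeff_map, hw, mul_comm, coeff_C_mul, coeff_map, mul_comm]
  have hr : algebraMap K F (coeff m f / coeff m g) = r := by
    rw [map_div₀, hcoeff, mul_div_cancel_left₀]
    simpa using hm
  have hfg : f = C (coeff m f / coeff m g) * g := by
    apply map_injective _ (algebraMap K F).injective
    rw [hw, map_mul, map_C, hr, mul_comm]
  refine ⟨_, fun h0 => hf0 ?_, hfg⟩
  rw [hfg, h0, C_0, zero_mul]

namespace GenusOne

/-! ### The pulled back discriminant as a function on models -/

section Naturality

variable {K : Type*} [Field K] {A B : Type*} [CommRing A] [CommRing B] [Algebra K A] [Algebra K B]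

theorem map_quarticMap (f : A →ₐ[K] B) (a b c d e : A) (i : Fin 2) :
    f (quarticMap K a b c d e i) = quarticMap K (f a) (f b) (f c) (f d) (f e) i := by
  fin_cases i <;> simp [quarticMap, quarticI, quarticJ, map_ofNat]

theorem map_pencilDet (f : A →ₐ[K] B) (φ : Fin 20 → A) :
    (pencilDet K φ).map (f : A →+* B) = pencilDet K (f ∘ φ) := by
  rw [pencilDet, ← Polynomial.coe_mapRingHom, RingHom.map_det, pencilDet]
  congr 1
  ext1 i j
  fin_cases i <;> fin_cases j <;> simp [quadricMatrix, quadricPair]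

theorem map_weierstrassMap₁ (f : A →ₐ[K] B) (φ : Fin 5 → A) (i : Fin 2) :
    f (weierstrassMap₁ K φ i) = weierstrassMap₁ K (f ∘ φ) i := by
  fin_cases i <;> simp [weierstrassMap₁, weierstrassCurve, WeierstrassCurve.c₄,
    WeierstrassCurve.c₆, WeierstrassCurve.b₂, WeierstrassCurve.b₄, WeierstrassCurve.b₆, map_ofNat]

theorem map_weierstrassMap₂ (f : A →ₐ[K] B) (φ : Fin 8 → A) (i : Fin 2) :
    f (weierstrassMap₂ K φ i) = weierstrassMap₂ K (f ∘ φ) i := by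
  rw [weierstrassMap₂, map_quarticMap]
  simp [weierstrassMap₂, map_ofNat]

theorem map_weierstrassMap₃ (f : A →ₐ[K] B) (φ : Fin 10 → A) (i : Fin 2) :
    f (weierstrassMap₃ K φ i) = weierstrassMap₃ K (f ∘ φ) i := by
  fin_cases i
  · simp only [weierstrassMap₃, cubicS, Fin.zero_eta, Matrix.cons_val_zero, map_mul, map_neg,
      map_sub, map_add, map_pow, map_smul, map_ofNat, Function.comp]
  · simp only [weierstrassMap₃, cubicT, Fin.mk_one, Matrix.cons_val_one, Matrix.cons_val_fin_one,
      map_mul, map_sub, map_add, map_pow, map_smul, map_ofNat, Function.comp]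

theorem map_weierstrassMap₄ (f : A →ₐ[K] B) (φ : Fin 20 → A) (i : Fin 2) :
    f (weierstrassMap₄ K φ i) = weierstrassMap₄ K (f ∘ φ) i := by
  have h (k : ℕ) : f ((pencilDet K φ).coeff k) = (pencilDet K (f ∘ φ)).coeff k := by
    rw [← map_pencilDet, Polynomial.coeff_map]
    rfl
  rw [weierstrassMap₄, map_quarticMap, h, h, h, h, h, weierstrassMap₄]

/-- The map `φ_n` is polynomial with coefficients in `K`, so it commutes with maps of
`K`-algebras. -/
theorem map_weierstrassMap (f : A →ₐ[K] B) :
    ∀ (n : ℕ) (φ : Model n A) (i : Fin 2),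
      f (weierstrassMap K n φ i) = weierstrassMap K n (f ∘ φ) i
  | 0, _, _ => map_zero f
  | 1, φ, i => map_weierstrassMap₁ f φ i
  | 2, φ, i => map_weierstrassMap₂ f φ i
  | 3, φ, i => map_weierstrassMap₃ f φ i
  | 4, φ, i => map_weierstrassMap₄ f φ i
  | _ + 5, _, _ => map_zero f

/-- The value of the pulled back discriminant `φ_n^*(Δ_W)` at a model with coefficients in any
`K`-algebra. -/
theorem aeval_pullback_weierstrassDisc (n : ℕ) (φ : Model n A) :
    aeval φ (pullback K n (weierstrassDisc K)) =
      2 ^ 12 * (weierstrassMap K n φ 0 ^ 3 - 27 * weierstrassMap K n φ 1 ^ 2) := by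
  have h (i : Fin 2) :
      aeval φ (weierstrassMap K n (X : Model n (MvPolynomial (Fin (modelDim n)) K)) i) =
        weierstrassMap K n φ i := by
    rw [map_weierstrassMap]
    congr 1
    ext i
    simp
  simp only [pullback, weierstrassDisc, map_mul, map_sub, map_pow, aeval_X, h, map_ofNat]

end Naturality

/-- The criterion for `φ_n^*(Δ_W)` to be a discriminant: it has to vanish exactly at the singular
models, these have to be the image of an affine space under a polynomial map `ψ`, and
`φ_n^*(Δ_W)` has to have a simple zero at the parameter `0` on some family of models `l`. -/
theorem isDiscriminant_pullback {K : Type*} [Field K] (h2 : (2 : K) ≠ 0) (n : ℕ)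
    (hsing : ∀ φ : Model n (AlgebraicClosure K), IsSingular n φ ↔
      weierstrassMap K n φ 0 ^ 3 - 27 * weierstrassMap K n φ 1 ^ 2 = 0)
    {τ : Type*} (ψ : Fin (modelDim n) → MvPolynomial τ (AlgebraicClosure K))
    (hψ : ∀ φ : Model n (AlgebraicClosure K), IsSingular n φ ↔
      ∃ t : τ → AlgebraicClosure K, ∀ i, eval t (ψ i) = φ i)
    (l : Model n (Polynomial (AlgebraicClosure K)))
    (g : Fin 2 → Polynomial (AlgebraicClosure K)) (hg : weierstrassMap K n l = g)
    (r : AlgebraicClosure K) (hr : r ≠ 0)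
    (u : Polynomial (AlgebraicClosure K)) (hu : u.eval 0 ≠ 0)
    (hl : Polynomial.C r * (g 0 ^ 3 - 27 * g 1 ^ 2) = Polynomial.X * u) :
    IsDiscriminant K n (pullback K n (weierstrassDisc K)) := by
  have h2' : (2 : AlgebraicClosure K) ≠ 0 := by
    have := (map_ne_zero (algebraMap K (AlgebraicClosure K))).mpr h2
    rwa [map_ofNat] at this
  have hzero (φ : Model n (AlgebraicClosure K)) :
      aeval φ (pullback K n (weierstrassDisc K)) = 0 ↔ IsSingular n φ := by
    rw [aeval_pullback_weierstrassDisc, hsing, mul_eq_zero_iff_left (pow_ne_zero _ h2')]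
  refine ⟨irreducible_of_zeroLocus_eq_range _ ψ (fun φ => ?_) l
    (Polynomial.C (2 ^ 12 * r⁻¹) * u) ?_ ?_, hzero⟩
  · rw [eval_map, ← aeval_def, hzero, hψ]
  · rw [aeval_map_algebraMap, aeval_pullback_weierstrassDisc, hg,
      mul_left_comm Polynomial.X, ← hl, ← mul_assoc, ← Polynomial.C_mul, mul_assoc (2 ^ 12),
      inv_mul_cancel₀ hr, mul_one, map_pow, map_ofNat]
  · simp [hr, h2', hu]

/-- A discriminant is determined up to a constant by its zeros. -/
theorem IsDiscriminant.exists_eq_C_mul {K : Type*} [Field K] {n : ℕ}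
    {Δ Δ' : MvPolynomial (Fin (modelDim n)) K} (h : IsDiscriminant K n Δ)
    (h' : IsDiscriminant K n Δ') : ∃ c : K, c ≠ 0 ∧ Δ = C c * Δ' :=
  exists_eq_C_mul_of_zeroLocus_eq h.irreducible h'.irreducible fun φ hφ =>
    (h.eq_zero_iff φ).mpr ((h'.eq_zero_iff φ).mp hφ)

/-! ### Binary quartic forms -/

section Binary

variable {F : Type*} [Field F]

/-- A binary form of positive degree over an algebraically closed field has a nontrivial zero. -/
theorem exists_binary_zero [IsAlgClosed F] (n : ℕ) (c : ℕ → F) :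
    ∃ r s : F, (r ≠ 0 ∨ s ≠ 0) ∧
      ∑ i ∈ Finset.range (n + 2), c i * r ^ i * s ^ (n + 1 - i) = 0 := by
  by_cases hc : c (n + 1) = 0
  · refine ⟨1, 0, Or.inl one_ne_zero, ?_⟩
    rw [Finset.sum_range_succ, hc, Finset.sum_eq_zero]
    · simp
    · intro i hi
      rw [zero_pow (by have := Finset.mem_range.mp hi; omega), mul_zero]
  · set p : Polynomial F := ∑ i ∈ Finset.range (n + 2), Polynomial.C (c i) * Polynomial.X ^ i
      with hp
    have hcoeff : p.coeff (n + 1) = c (n + 1) := by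
      simp [hp, Polynomial.finsetSum_coeff, Polynomial.coeff_C_mul, Polynomial.coeff_X_pow]
    have hdeg : p.degree ≠ 0 := by
      intro h
      have := Polynomial.coeff_eq_zero_of_degree_lt (p := p) (n := n + 1)
        (by rw [h]; exact_mod_cast Nat.succ_pos n)
      exact hc (hcoeff ▸ this)
    obtain ⟨r, hr⟩ := IsAlgClosed.exists_root p hdeg
    refine ⟨r, 1, Or.inr one_ne_zero, ?_⟩
    simpa [hp, Polynomial.eval_finsetSum] using hr

/-- A binary quartic that vanishes at `(r, s)` is divisible by `sx - rz`. -/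
theorem exists_quartic_factor {a b c d e r s : F} (hrs : r ≠ 0 ∨ s ≠ 0)
    (h : a * r ^ 4 + b * r ^ 3 * s + c * r ^ 2 * s ^ 2 + d * r * s ^ 3 + e * s ^ 4 = 0) :
    ∃ k l m n : F, a = s * k ∧ b = s * l - r * k ∧ c = s * m - r * l ∧ d = s * n - r * m ∧
      e = -(r * n) := by
  rcases hrs with hr | hs
  · refine ⟨(s * ((s * ((s * (-e / r) - d) / r) - c) / r) - b) / r,
      (s * ((s * (-e / r) - d) / r) - c) / r, (s * (-e / r) - d) / r, -e / r, ?_, ?_, ?_, ?_, ?_⟩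
    · field_simp
      linear_combination h
    all_goals field_simp; try ring
  · refine ⟨a / s, (b + r * (a / s)) / s, (c + r * ((b + r * (a / s)) / s)) / s,
      (d + r * ((c + r * ((b + r * (a / s)) / s)) / s)) / s, ?_, ?_, ?_, ?_, ?_⟩
    on_goal 5 => field_simp; linear_combination h
    all_goals field_simp; try ring

theorem exists_cubic_factor {a b c d r s : F} (hrs : r ≠ 0 ∨ s ≠ 0)
    (h : a * r ^ 3 + b * r ^ 2 * s + c * r * s ^ 2 + d * s ^ 3 = 0) :
    ∃ k l m : F, a = s * k ∧ b = s * l - r * k ∧ c = s * m - r * l ∧ d = -(r * m) := by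
  rcases hrs with hr | hs
  · refine ⟨(s * ((s * (-d / r) - c) / r) - b) / r, (s * (-d / r) - c) / r, -d / r,
      ?_, ?_, ?_, ?_⟩
    · field_simp
      linear_combination h
    all_goals field_simp; try ring
  · refine ⟨a / s, (b + r * (a / s)) / s, (c + r * ((b + r * (a / s)) / s)) / s, ?_, ?_, ?_, ?_⟩
    on_goal 4 => field_simp; linear_combination h
    all_goals field_simp; try ring

theorem exists_quadratic_factor {a b c r s : F} (hrs : r ≠ 0 ∨ s ≠ 0)
    (h : a * r ^ 2 + b * r * s + c * s ^ 2 = 0) :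
    ∃ k l : F, a = s * k ∧ b = s * l - r * k ∧ c = -(r * l) := by
  rcases hrs with hr | hs
  · refine ⟨(s * (-c / r) - b) / r, -c / r, ?_, ?_, ?_⟩
    · field_simp
      linear_combination h
    all_goals field_simp; try ring
  · refine ⟨a / s, (b + r * (a / s)) / s, ?_, ?_, ?_⟩
    on_goal 3 => field_simp; linear_combination h
    all_goals field_simp; try ring

theorem exists_linear_factor {a b r s : F} (hrs : r ≠ 0 ∨ s ≠ 0) (h : a * r + b * s = 0) :
    ∃ k : F, a = s * k ∧ b = -(r * k) := by
  rcases hrs with hr | hs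
  · refine ⟨-b / r, ?_, ?_⟩ <;> field_simp
    linear_combination h
  · refine ⟨a / s, ?_, ?_⟩ <;> field_simp
    linear_combination h

/-- A quadratic form in two variables over an algebraically closed field has a nontrivial zero. -/
theorem exists_quadratic_zero [IsAlgClosed F] (a b c : F) :
    ∃ r s : F, (r ≠ 0 ∨ s ≠ 0) ∧ a * r ^ 2 + b * r * s + c * s ^ 2 = 0 := by
  obtain ⟨r, s, hrs, h⟩ := exists_binary_zero 1 (![c, b, a] ∘ Fin.ofNat 3)
  refine ⟨r, s, hrs, ?_⟩
  simp [Finset.sum_range_succ, Fin.ofNat] at h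
  linear_combination h

theorem exists_cubic_zero [IsAlgClosed F] (a b c d : F) :
    ∃ r s : F, (r ≠ 0 ∨ s ≠ 0) ∧ a * r ^ 3 + b * r ^ 2 * s + c * r * s ^ 2 + d * s ^ 3 = 0 := by
  obtain ⟨r, s, hrs, h⟩ := exists_binary_zero 2 (![d, c, b, a] ∘ Fin.ofNat 4)
  refine ⟨r, s, hrs, ?_⟩
  simp [Finset.sum_range_succ, Fin.ofNat] at h
  linear_combination h

theorem exists_quartic_zero [IsAlgClosed F] (a b c d e : F) :
    ∃ r s : F, (r ≠ 0 ∨ s ≠ 0) ∧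
      a * r ^ 4 + b * r ^ 3 * s + c * r ^ 2 * s ^ 2 + d * r * s ^ 3 + e * s ^ 4 = 0 := by
  obtain ⟨r, s, hrs, h⟩ := exists_binary_zero 3 (![e, d, c, b, a] ∘ Fin.ofNat 5)
  refine ⟨r, s, hrs, ?_⟩
  simp [Finset.sum_range_succ, Fin.ofNat] at h
  linear_combination h

end Binary

/-- The combination `4I³ - J²` of the integral invariants `I = 12 i` and `J = 432 j` of the quartic
`ax⁴ + bx³z + cx²z² + dxz³ + ez⁴`. It is `27` times the usual discriminant. -/
def quarticDisc {R : Type*} [CommRing R] (a b c d e : R) : R :=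
  4 * (12 * a * e - 3 * b * d + c ^ 2) ^ 3
    - (72 * a * c * e - 27 * a * d ^ 2 - 27 * b ^ 2 * e + 9 * b * c * d - 2 * c ^ 3) ^ 2

theorem quarticDisc_eq {K A : Type*} [Field K] [CommRing A] [Algebra K A] (h2 : (2 : K) ≠ 0)
    (h3 : (3 : K) ≠ 0) (a b c d e : A) :
    6912 * (quarticMap K a b c d e 0 ^ 3 - 27 * quarticMap K a b c d e 1 ^ 2) =
      quarticDisc a b c d e := by
  have h12 : (12 : K) ≠ 0 := by
    rw [show (12 : K) = 2 ^ 2 * 3 by norm_num]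
    positivity
  have h432 : (432 : K) ≠ 0 := by
    rw [show (432 : K) = 2 ^ 4 * 3 ^ 3 by norm_num]
    positivity
  have hu : 12 * algebraMap K A 12⁻¹ = 1 := by
    rw [← map_ofNat (algebraMap K A), ← map_mul, mul_inv_cancel₀ h12, map_one]
  have hv : 432 * algebraMap K A 432⁻¹ = 1 := by
    rw [← map_ofNat (algebraMap K A), ← map_mul, mul_inv_cancel₀ h432, map_one]
  simp only [quarticMap, quarticI, quarticJ, Matrix.cons_val_zero, Matrix.cons_val_one,
    Matrix.cons_val_fin_one, Algebra.smul_def, quarticDisc]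
  generalize algebraMap K A 12⁻¹ = u at *
  generalize algebraMap K A 432⁻¹ = v at *
  generalize 12 * a * e - 3 * b * d + c ^ 2 = I
  generalize 72 * a * c * e - 27 * a * d ^ 2 - 27 * b ^ 2 * e + 9 * b * c * d - 2 * c ^ 3 = J
  linear_combination 4 * I ^ 3 * (144 * u ^ 2 + 12 * u + 1) * hu - J ^ 2 * (432 * v + 1) * hv

section Discriminant

variable {F : Type*} [Field F]

/-- A binary quartic with discriminant zero is divisible by the square of a linear form. The
linear factors are split off one at a time: if the quartic is a linear form times a form `g`,
then its discriminant is that of `g` times the square of the value of `g` at the zero of the linear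
form. -/
theorem exists_sq_factor_of_quarticDisc_eq_zero [IsAlgClosed F] (h3 : (3 : F) ≠ 0) {a b c d e : F}
    (h : quarticDisc a b c d e = 0) :
    ∃ r s k l m : F, (r ≠ 0 ∨ s ≠ 0) ∧ a = s ^ 2 * k ∧ b = s ^ 2 * l - 2 * r * s * k ∧
      c = s ^ 2 * m - 2 * r * s * l + r ^ 2 * k ∧ d = r ^ 2 * l - 2 * r * s * m ∧
      e = r ^ 2 * m := by
  obtain ⟨r, s, hrs, h0⟩ := exists_quartic_zero a b c d e
  obtain ⟨a₁, b₁, c₁, d₁, rfl, rfl, rfl, rfl, rfl⟩ := exists_quartic_factor hrs h0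
  have h27 : (27 : F) ≠ 0 := by
    rw [show (27 : F) = 3 ^ 3 by norm_num]
    exact pow_ne_zero _ h3
  have h1 : 27 * (b₁ ^ 2 * c₁ ^ 2 - 4 * a₁ * c₁ ^ 3 - 4 * b₁ ^ 3 * d₁ - 27 * a₁ ^ 2 * d₁ ^ 2
      + 18 * a₁ * b₁ * c₁ * d₁)
      * (a₁ * r ^ 3 + b₁ * r ^ 2 * s + c₁ * r * s ^ 2 + d₁ * s ^ 3) ^ 2 = 0 := by
    rw [← h, quarticDisc]
    ring
  rcases mul_eq_zero.mp h1 with h1 | h1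
  · replace h1 := (mul_eq_zero.mp h1).resolve_left h27
    obtain ⟨r', s', hrs', h0'⟩ := exists_cubic_zero a₁ b₁ c₁ d₁
    obtain ⟨a₂, b₂, c₂, rfl, rfl, rfl, rfl⟩ := exists_cubic_factor hrs' h0'
    have h2 : (b₂ ^ 2 - 4 * a₂ * c₂) * (a₂ * r' ^ 2 + b₂ * r' * s' + c₂ * s' ^ 2) ^ 2 = 0 := by
      rw [← h1]
      ring
    rcases mul_eq_zero.mp h2 with h2 | h2
    · obtain ⟨r₂, s₂, hrs₂, h0₂⟩ := exists_quadratic_zero a₂ b₂ c₂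
      obtain ⟨a₃, b₃, rfl, rfl, rfl⟩ := exists_quadratic_factor hrs₂ h0₂
      have h3 : (a₃ * r₂ + b₃ * s₂) ^ 2 = 0 := by
        rw [← h2]
        ring
      obtain ⟨t, rfl, rfl⟩ := exists_linear_factor hrs₂ (pow_eq_zero_iff two_ne_zero |>.mp h3)
      exact ⟨r₂, s₂, s * s' * t, -(s * r' + r * s') * t, r * r' * t, hrs₂, by ring, by ring,
        by ring, by ring, by ring⟩
    · obtain ⟨a₃, b₃, rfl, rfl, rfl⟩ :=
        exists_quadratic_factor hrs' (pow_eq_zero_iff two_ne_zero |>.mp h2)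
      exact ⟨r', s', s * a₃, s * b₃ - r * a₃, -(r * b₃), hrs', by ring, by ring, by ring, by ring,
        by ring⟩
  · obtain ⟨a₂, b₂, c₂, rfl, rfl, rfl, rfl⟩ :=
      exists_cubic_factor hrs (pow_eq_zero_iff two_ne_zero |>.mp h1)
    exact ⟨r, s, a₂, b₂, c₂, hrs, by ring, by ring, by ring, by ring, by ring⟩

theorem quarticDisc_eq_zero_of_sq_factor {R : Type*} [CommRing R] (r s k l m : R) :
    quarticDisc (s ^ 2 * k) (s ^ 2 * l - 2 * r * s * k)
      (s ^ 2 * m - 2 * r * s * l + r ^ 2 * k) (r ^ 2 * l - 2 * r * s * m) (r ^ 2 * m) = 0 := by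
  rw [quarticDisc]
  ring

/-- A zero `(r, s)` of both partial derivatives of a binary quartic gives the square factor
`(sx - rz)²`. -/
theorem exists_sq_factor_of_deriv_eq_zero (h2 : (2 : F) ≠ 0) {a b c d e r s : F}
    (hrs : r ≠ 0 ∨ s ≠ 0)
    (hx : 4 * a * r ^ 3 + 3 * b * r ^ 2 * s + 2 * c * r * s ^ 2 + d * s ^ 3 = 0)
    (hz : b * r ^ 3 + 2 * c * r ^ 2 * s + 3 * d * r * s ^ 2 + 4 * e * s ^ 3 = 0) :
    ∃ k l m : F, a = s ^ 2 * k ∧ b = s ^ 2 * l - 2 * r * s * k ∧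
      c = s ^ 2 * m - 2 * r * s * l + r ^ 2 * k ∧ d = r ^ 2 * l - 2 * r * s * m ∧
      e = r ^ 2 * m := by
  have h4 : (2 : F) * 2 ≠ 0 := mul_ne_zero h2 h2
  have h0 : a * r ^ 4 + b * r ^ 3 * s + c * r ^ 2 * s ^ 2 + d * r * s ^ 3 + e * s ^ 4 = 0 := by
    apply mul_left_cancel₀ h4
    linear_combination r * hx + s * hz
  obtain ⟨a₁, b₁, c₁, d₁, rfl, rfl, rfl, rfl, rfl⟩ := exists_quartic_factor hrs h0
  have h1 : a₁ * r ^ 3 + b₁ * r ^ 2 * s + c₁ * r * s ^ 2 + d₁ * s ^ 3 = 0 := by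
    rcases hrs with hr | hs
    · apply mul_left_cancel₀ hr
      linear_combination -hz
    · apply mul_left_cancel₀ hs
      linear_combination hx
  obtain ⟨a₂, b₂, c₂, rfl, rfl, rfl, rfl⟩ := exists_cubic_factor hrs h1
  exact ⟨a₂, b₂, c₂, by ring, by ring, by ring, by ring, by ring⟩

/-- The discriminant of a binary quartic vanishes if and only if its partial derivatives have a
common nontrivial zero. -/
theorem quarticDisc_eq_zero_iff [IsAlgClosed F] (h2 : (2 : F) ≠ 0) (h3 : (3 : F) ≠ 0)
    (a b c d e : F) :
    quarticDisc a b c d e = 0 ↔ ∃ r s : F, (r ≠ 0 ∨ s ≠ 0) ∧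
      4 * a * r ^ 3 + 3 * b * r ^ 2 * s + 2 * c * r * s ^ 2 + d * s ^ 3 = 0 ∧
      b * r ^ 3 + 2 * c * r ^ 2 * s + 3 * d * r * s ^ 2 + 4 * e * s ^ 3 = 0 := by
  constructor
  · intro h
    obtain ⟨r, s, k, l, m, hrs, rfl, rfl, rfl, rfl, rfl⟩ :=
      exists_sq_factor_of_quarticDisc_eq_zero h3 h
    exact ⟨r, s, hrs, by ring, by ring⟩
  · rintro ⟨r, s, hrs, hx, hz⟩
    obtain ⟨k, l, m, rfl, rfl, rfl, rfl, rfl⟩ := exists_sq_factor_of_deriv_eq_zero h2 hrs hx hz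
    exact quarticDisc_eq_zero_of_sq_factor r s k l m

/-- The discriminant of the quartic `x³z + x²z² - txz³ - tz⁴`. -/
theorem quarticDisc_line {R : Type*} [CommRing R] (t : R) :
    quarticDisc 0 1 1 (-t) (-t) = t * (108 * (1 - t) ^ 2) := by
  rw [quarticDisc]
  ring

end Discriminant

/-! ### Models of degree 1 -/

section DegreeOne

/-- The Weierstrass equation with coefficients `a₁, a₂` and a singular point at `(r, s)`, for the
parameters `(r, s, a₁, a₂)`. -/
def singularModel₁ {R : Type*} [CommRing R] (t : Fin 4 → R) : Fin 5 → R :=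
  let a₃ := -(2 * t 1 + t 2 * t 0)
  let a₄ := t 2 * t 1 - 3 * t 0 ^ 2 - 2 * t 3 * t 0
  ![t 2, t 3, a₃, a₄, t 1 ^ 2 + t 2 * t 0 * t 1 + a₃ * t 1 - t 0 ^ 3 - t 3 * t 0 ^ 2 - a₄ * t 0]

theorem weierstrassMap₁_disc {K A : Type*} [Field K] [CommRing A] [Algebra K A] (h2 : (2 : K) ≠ 0)
    (h3 : (3 : K) ≠ 0) (φ : Fin 5 → A) :
    1728 * (weierstrassMap₁ K φ 0 ^ 3 - 27 * weierstrassMap₁ K φ 1 ^ 2) =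
      (weierstrassCurve φ).c₄ ^ 3 - (weierstrassCurve φ).c₆ ^ 2 := by
  have h12 : (12 : K) ≠ 0 := by
    rw [show (12 : K) = 2 ^ 2 * 3 by norm_num]
    positivity
  have h216 : (216 : K) ≠ 0 := by
    rw [show (216 : K) = 2 ^ 3 * 3 ^ 3 by norm_num]
    positivity
  have hu : 12 * algebraMap K A 12⁻¹ = 1 := by
    rw [← map_ofNat (algebraMap K A), ← map_mul, mul_inv_cancel₀ h12, map_one]
  have hv : 216 * algebraMap K A 216⁻¹ = 1 := by
    rw [← map_ofNat (algebraMap K A), ← map_mul, mul_inv_cancel₀ h216, map_one]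
  simp only [weierstrassMap₁, Matrix.cons_val_zero, Matrix.cons_val_one,
    Matrix.cons_val_fin_one, Algebra.smul_def]
  generalize algebraMap K A 12⁻¹ = u at *
  generalize algebraMap K A 216⁻¹ = v at *
  generalize (weierstrassCurve φ).c₄ = c
  generalize (weierstrassCurve φ).c₆ = d
  linear_combination c ^ 3 * (144 * u ^ 2 + 12 * u + 1) * hu - d ^ 2 * (216 * v + 1) * hv

theorem eval_singularModel₁ {R : Type*} [CommRing R] (t : Fin 4 → R) (i : Fin 5) :
    eval t (singularModel₁ X i) = singularModel₁ t i := by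
  fin_cases i <;> simp [singularModel₁, map_ofNat]

variable {F : Type*} [Field F]

theorem isSingularZero_weierstrass_iff (φ : Fin 5 → F) (P : Fin 3 → F) :
    IsSingularZero (weierstrassCurve φ).toProjective.polynomial P ↔
      P 1 ^ 2 * P 2 + φ 0 * P 0 * P 1 * P 2 + φ 2 * P 1 * P 2 ^ 2
        - (P 0 ^ 3 + φ 1 * P 0 ^ 2 * P 2 + φ 3 * P 0 * P 2 ^ 2 + φ 4 * P 2 ^ 3) = 0 ∧
      φ 0 * P 1 * P 2 - (3 * P 0 ^ 2 + 2 * φ 1 * P 0 * P 2 + φ 3 * P 2 ^ 2) = 0 ∧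
      2 * P 1 * P 2 + φ 0 * P 0 * P 2 + φ 2 * P 2 ^ 2 = 0 ∧
      P 1 ^ 2 + φ 0 * P 0 * P 1 + 2 * φ 2 * P 1 * P 2
        - (φ 1 * P 0 ^ 2 + 2 * φ 3 * P 0 * P 2 + 3 * φ 4 * P 2 ^ 2) = 0 := by
  have hX := (weierstrassCurve φ).toProjective.eval_polynomialX P
  have hY := (weierstrassCurve φ).toProjective.eval_polynomialY P
  have hZ := (weierstrassCurve φ).toProjective.eval_polynomialZ P
  have h0 := (weierstrassCurve φ).toProjective.equation_iff P
  rw [WeierstrassCurve.Projective.polynomialX] at hX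
  rw [WeierstrassCurve.Projective.polynomialY] at hY
  rw [WeierstrassCurve.Projective.polynomialZ] at hZ
  rw [WeierstrassCurve.Projective.Equation] at h0
  simp only [IsSingularZero, Fin.forall_fin_succ, IsEmpty.forall_iff, and_true,
    Fin.succ_zero_eq_one, Fin.succ_one_eq_two, hX, hY, hZ, h0]
  rfl

/-- A point at infinity is never singular, so the singular Weierstrass equations are those with a
singular affine point `(r, s)`. -/
theorem exists_isSingularZero_weierstrass_iff (φ : Fin 5 → F) :
    (∃ P : Fin 3 → F, P ≠ 0 ∧ IsSingularZero (weierstrassCurve φ).toProjective.polynomial P) ↔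
      ∃ t : Fin 4 → F, ∀ i, singularModel₁ t i = φ i := by
  simp only [isSingularZero_weierstrass_iff]
  constructor
  · rintro ⟨P, hP, h0, hx, hy, hz⟩
    have hP2 : P 2 ≠ 0 := by
      intro h
      have hP0 : P 0 = 0 := by simpa [h] using h0
      have hP1 : P 1 = 0 := by simpa [h, hP0] using hz
      refine hP (_root_.funext fun i => ?_)
      fin_cases i <;> assumption
    obtain ⟨r, hr⟩ : ∃ r, P 0 = r * P 2 := ⟨P 0 / P 2, by field_simp⟩
    obtain ⟨s, hs⟩ : ∃ s, P 1 = s * P 2 := ⟨P 1 / P 2, by field_simp⟩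
    rw [hr, hs] at h0 hx hy
    have hx' : φ 0 * s - (3 * r ^ 2 + 2 * φ 1 * r + φ 3) = 0 := by
      apply mul_left_cancel₀ (pow_ne_zero 2 hP2)
      linear_combination hx
    have hy' : 2 * s + φ 0 * r + φ 2 = 0 := by
      apply mul_left_cancel₀ (pow_ne_zero 2 hP2)
      linear_combination hy
    have h0' : s ^ 2 + φ 0 * r * s + φ 2 * s - (r ^ 3 + φ 1 * r ^ 2 + φ 3 * r + φ 4) = 0 := by
      apply mul_left_cancel₀ (pow_ne_zero 3 hP2)
      linear_combination h0
    refine ⟨![r, s, φ 0, φ 1], fun i => ?_⟩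
    fin_cases i <;> simp [singularModel₁]
    · linear_combination -hy'
    · linear_combination hx'
    · linear_combination h0' - s * hy' - r * hx'
  · rintro ⟨t, ht⟩
    refine ⟨![t 0, t 1, 1], fun h => one_ne_zero (congrFun h 2), ?_⟩
    simp [← ht, singularModel₁]
    ring

theorem exists_isSingularZero_weierstrass_iff_c₄_c₆ [IsAlgClosed F] (h2 : (2 : F) ≠ 0)
    (h3 : (3 : F) ≠ 0) (φ : Fin 5 → F) :
    (∃ P : Fin 3 → F, P ≠ 0 ∧ IsSingularZero (weierstrassCurve φ).toProjective.polynomial P) ↔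
      (weierstrassCurve φ).c₄ ^ 3 - (weierstrassCurve φ).c₆ ^ 2 = 0 := by
  rw [exists_isSingularZero_weierstrass_iff]
  simp only [weierstrassCurve, WeierstrassCurve.c₄, WeierstrassCurve.c₆, WeierstrassCurve.b₂,
    WeierstrassCurve.b₄, WeierstrassCurve.b₆]
  constructor
  · rintro ⟨t, ht⟩
    simp only [← ht, singularModel₁, Matrix.cons_val]
    ring
  · intro h
    have h4 : (4 : F) ≠ 0 := by
      rw [show (4 : F) = 2 ^ 2 by norm_num]
      exact pow_ne_zero _ h2
    -- A singular point is a double zero of `4x³ + b₂x² + 2b₄x + b₆`.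
    have hd : quarticDisc 0 4 (φ 0 ^ 2 + 4 * φ 1) (2 * (2 * φ 3 + φ 0 * φ 2))
        (φ 2 ^ 2 + 4 * φ 4) = 0 := by
      rw [quarticDisc]
      linear_combination 4 * h
    obtain ⟨r, s, hrs, hx, hz⟩ := (quarticDisc_eq_zero_iff h2 h3 _ _ _ _ _).mp hd
    have hs : s ≠ 0 := by
      rintro rfl
      have : r ^ 3 = 0 := by
        apply mul_left_cancel₀ h4
        linear_combination hz
      simp_all
    obtain ⟨x, rfl⟩ : ∃ x, r = x * s := ⟨r / s, by field_simp⟩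
    have hx' : 12 * x ^ 2 + 2 * (φ 0 ^ 2 + 4 * φ 1) * x + 2 * (2 * φ 3 + φ 0 * φ 2) = 0 := by
      apply mul_left_cancel₀ (pow_ne_zero 3 hs)
      linear_combination hx
    have hz' : 4 * x ^ 3 + 2 * (φ 0 ^ 2 + 4 * φ 1) * x ^ 2 + 6 * (2 * φ 3 + φ 0 * φ 2) * x
        + 4 * (φ 2 ^ 2 + 4 * φ 4) = 0 := by
      apply mul_left_cancel₀ (pow_ne_zero 3 hs)
      linear_combination hz
    obtain ⟨y, hy⟩ : ∃ y, 2 * y = -(φ 0 * x + φ 2) :=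
      ⟨-(φ 0 * x + φ 2) / 2, by field_simp⟩
    refine ⟨![x, y, φ 0, φ 1], fun i => ?_⟩
    fin_cases i <;> simp [singularModel₁]
    · linear_combination -hy
    · apply mul_left_cancel₀ h4
      linear_combination 2 * φ 0 * hy - hx'
    · apply mul_left_cancel₀ (mul_ne_zero h4 h4)
      linear_combination (4 * (2 * y + φ 0 * x + φ 2) - 16 * y - 8 * φ 0 * x) * hy + 3 * x * hx'
        - hz'

end DegreeOne

theorem isDiscriminant_one {K : Type*} [Field K] (h2 : (2 : K) ≠ 0) (h3 : (3 : K) ≠ 0)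
    (h2' : (2 : AlgebraicClosure K) ≠ 0) (h3' : (3 : AlgebraicClosure K) ≠ 0) :
    IsDiscriminant K 1 (pullback K 1 (weierstrassDisc K)) := by
  have h1728 : (1728 : AlgebraicClosure K) ≠ 0 := by
    rw [show (1728 : AlgebraicClosure K) = 2 ^ 6 * 3 ^ 3 by norm_num]
    positivity
  have h110592 : (110592 : AlgebraicClosure K) ≠ 0 := by
    rw [show (110592 : AlgebraicClosure K) = 2 ^ 12 * 3 ^ 3 by norm_num]
    positivity
  have hsing (φ : Fin 5 → AlgebraicClosure K) :
      (∃ P : Fin 3 → AlgebraicClosure K, P ≠ 0 ∧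
        IsSingularZero (weierstrassCurve φ).toProjective.polynomial P) ↔
      weierstrassMap₁ K φ 0 ^ 3 - 27 * weierstrassMap₁ K φ 1 ^ 2 = 0 := by
    rw [exists_isSingularZero_weierstrass_iff_c₄_c₆ h2' h3', ← weierstrassMap₁_disc h2 h3,
      mul_eq_zero_iff_left h1728]
  -- The family `y² = (x + 1)(x² - t)`.
  refine isDiscriminant_pullback h2 1 hsing
    (fun i => singularModel₁ X i) (fun φ => ?_)
    ![0, 1, 0, -Polynomial.X, -Polynomial.X] (weierstrassMap₁ K _) rfl 1728 h1728
    (110592 * (1 - Polynomial.X) ^ 2) (by simpa using h110592) ?_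
  · refine (exists_isSingularZero_weierstrass_iff φ).trans (exists_congr fun t => ?_)
    exact forall_congr' fun i => by rw [← eval_singularModel₁]
  · rw [map_ofNat]
    refine (weierstrassMap₁_disc h2 h3 _).trans ?_
    simp [weierstrassCurve, WeierstrassCurve.c₄, WeierstrassCurve.c₆, WeierstrassCurve.b₂,
      WeierstrassCurve.b₄, WeierstrassCurve.b₆]
    ring

/-! ### Models of degree 2 -/

section DegreeTwo

/-- The models `y² + py = q` with `p = 2(β₀x² + β₁xz + β₂z²)` for which the quartic `p² / 4 + q` is
`(sx - rz)² (kx² + lxz + mz²)`, for the parameters `(β₀, β₁, β₂, r, s, k, l, m)`. -/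
def singularModel₂ {R : Type*} [CommRing R] (t : Fin 8 → R) : Fin 8 → R :=
  ![2 * t 0, 2 * t 1, 2 * t 2,
    t 4 ^ 2 * t 5 - t 0 ^ 2,
    t 4 ^ 2 * t 6 - 2 * t 3 * t 4 * t 5 - 2 * t 0 * t 1,
    t 4 ^ 2 * t 7 - 2 * t 3 * t 4 * t 6 + t 3 ^ 2 * t 5 - t 1 ^ 2 - 2 * t 0 * t 2,
    t 3 ^ 2 * t 6 - 2 * t 3 * t 4 * t 7 - 2 * t 1 * t 2,
    t 3 ^ 2 * t 7 - t 2 ^ 2]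

theorem eval_singularModel₂ {R : Type*} [CommRing R] (t : Fin 8 → R) (i : Fin 8) :
    eval t (singularModel₂ X i) = singularModel₂ t i := by
  fin_cases i <;> simp [singularModel₂, map_ofNat]

variable {F : Type*} [Field F]

theorem isSingularZero_doubleCoverForm_iff (φ : Fin 8 → F) (P : Fin 3 → F) :
    IsSingularZero (doubleCoverForm φ) P ↔
      P 2 ^ 2 + (φ 0 * P 0 ^ 2 + φ 1 * P 0 * P 1 + φ 2 * P 1 ^ 2) * P 2
        - (φ 3 * P 0 ^ 4 + φ 4 * P 0 ^ 3 * P 1 + φ 5 * P 0 ^ 2 * P 1 ^ 2 + φ 6 * P 0 * P 1 ^ 3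
          + φ 7 * P 1 ^ 4) = 0 ∧
      (2 * φ 0 * P 0 + φ 1 * P 1) * P 2
        - (4 * φ 3 * P 0 ^ 3 + 3 * φ 4 * P 0 ^ 2 * P 1 + 2 * φ 5 * P 0 * P 1 ^ 2
          + φ 6 * P 1 ^ 3) = 0 ∧
      (φ 1 * P 0 + 2 * φ 2 * P 1) * P 2
        - (φ 4 * P 0 ^ 3 + 2 * φ 5 * P 0 ^ 2 * P 1 + 3 * φ 6 * P 0 * P 1 ^ 2
          + 4 * φ 7 * P 1 ^ 3) = 0 ∧
      2 * P 2 + (φ 0 * P 0 ^ 2 + φ 1 * P 0 * P 1 + φ 2 * P 1 ^ 2) = 0 := by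
  simp only [IsSingularZero, Fin.forall_fin_succ, IsEmpty.forall_iff, and_true,
    Fin.succ_zero_eq_one, Fin.succ_one_eq_two]
  refine and_congr (Eq.congr_left ?_) (and_congr (Eq.congr_left ?_)
    (and_congr (Eq.congr_left ?_) (Eq.congr_left ?_)))
  all_goals
    simp [doubleCoverForm, pderiv_X]
    try ring

/-- Completing the square, a model of degree 2 is singular if and only if the quartic
`p² / 4 + q` is divisible by the square of a linear form. -/
theorem exists_isSingularZero_doubleCoverForm_iff (h2 : (2 : F) ≠ 0) (φ : Fin 8 → F) :
    (∃ P : Fin 3 → F, ¬(P 0 = 0 ∧ P 1 = 0) ∧ IsSingularZero (doubleCoverForm φ) P) ↔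
      ∃ t : Fin 8 → F, ∀ i, singularModel₂ t i = φ i := by
  simp only [isSingularZero_doubleCoverForm_iff]
  constructor
  · rintro ⟨P, hP, h0, hx, hz, hy⟩
    obtain ⟨β₀, hβ₀⟩ : ∃ β, φ 0 = 2 * β := ⟨φ 0 / 2, by field_simp⟩
    obtain ⟨β₁, hβ₁⟩ : ∃ β, φ 1 = 2 * β := ⟨φ 1 / 2, by field_simp⟩
    obtain ⟨β₂, hβ₂⟩ : ∃ β, φ 2 = 2 * β := ⟨φ 2 / 2, by field_simp⟩
    simp only [hβ₀, hβ₁, hβ₂] at hx hz hy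
    have hy' : P 2 + (β₀ * P 0 ^ 2 + β₁ * P 0 * P 1 + β₂ * P 1 ^ 2) = 0 := by
      apply mul_left_cancel₀ h2
      linear_combination hy
    obtain ⟨k, l, m, ha, hb, hc, hd, he⟩ := exists_sq_factor_of_deriv_eq_zero h2
      (a := φ 3 + β₀ ^ 2) (b := φ 4 + 2 * β₀ * β₁) (c := φ 5 + β₁ ^ 2 + 2 * β₀ * β₂)
      (d := φ 6 + 2 * β₁ * β₂) (e := φ 7 + β₂ ^ 2) (r := P 0) (s := P 1) (by tauto)
      (by linear_combination (4 * β₀ * P 0 + 2 * β₁ * P 1) * hy' - hx)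
      (by linear_combination (2 * β₁ * P 0 + 4 * β₂ * P 1) * hy' - hz)
    refine ⟨![β₀, β₁, β₂, P 0, P 1, k, l, m], fun i => ?_⟩
    fin_cases i <;> simp [singularModel₂, hβ₀, hβ₁, hβ₂]
    · linear_combination -ha
    · linear_combination -hb
    · linear_combination -hc
    · linear_combination -hd
    · linear_combination -he
  · rintro ⟨t, ht⟩
    simp only [← ht, singularModel₂, Matrix.cons_val]
    by_cases hrs : t 3 = 0 ∧ t 4 = 0
    · refine ⟨![1, 0, -t 0], by simp, ?_⟩
      simp [hrs.1, hrs.2]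
      refine ⟨?_, ?_, ?_⟩ <;> ring
    · refine ⟨![t 3, t 4, -(t 0 * t 3 ^ 2 + t 1 * t 3 * t 4 + t 2 * t 4 ^ 2)], by simpa using hrs,
        ?_⟩
      simp
      refine ⟨?_, ?_, ?_, ?_⟩ <;> ring

theorem exists_isSingularZero_doubleCoverForm_iff_quarticDisc [IsAlgClosed F] (h2 : (2 : F) ≠ 0)
    (h3 : (3 : F) ≠ 0) (φ : Fin 8 → F) :
    (∃ P : Fin 3 → F, ¬(P 0 = 0 ∧ P 1 = 0) ∧ IsSingularZero (doubleCoverForm φ) P) ↔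
      quarticDisc (φ 3 + 4⁻¹ * φ 0 ^ 2) (φ 4 + 4⁻¹ * (2 * φ 0 * φ 1))
        (φ 5 + 4⁻¹ * (φ 1 ^ 2 + 2 * φ 0 * φ 2)) (φ 6 + 4⁻¹ * (2 * φ 1 * φ 2))
        (φ 7 + 4⁻¹ * φ 2 ^ 2) = 0 := by
  have h4 : (4 : F)⁻¹ = 2⁻¹ ^ 2 := by
    rw [inv_pow]
    norm_num
  rw [exists_isSingularZero_doubleCoverForm_iff h2, h4]
  constructor
  · rintro ⟨t, ht⟩
    rw [← quarticDisc_eq_zero_of_sq_factor (t 3) (t 4) (t 5) (t 6) (t 7)]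
    simp only [← ht, singularModel₂, Matrix.cons_val]
    congr 1 <;> field_simp <;> ring
  · intro h
    obtain ⟨r, s, k, l, m, -, ha, hb, hc, hd, he⟩ := exists_sq_factor_of_quarticDisc_eq_zero h3 h
    refine ⟨![2⁻¹ * φ 0, 2⁻¹ * φ 1, 2⁻¹ * φ 2, r, s, k, l, m], fun i => ?_⟩
    have h22 : (2 : F) * 2⁻¹ = 1 := mul_inv_cancel₀ h2
    fin_cases i <;> simp [singularModel₂, h2]
    · linear_combination -ha
    · linear_combination -hb + φ 0 * φ 1 * 2⁻¹ * h22
    · linear_combination -hc + φ 0 * φ 2 * 2⁻¹ * h22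
    · linear_combination -hd + φ 1 * φ 2 * 2⁻¹ * h22
    · linear_combination -he

end DegreeTwo

theorem isDiscriminant_two {K : Type*} [Field K] (h2 : (2 : K) ≠ 0) (h3 : (3 : K) ≠ 0)
    (h2' : (2 : AlgebraicClosure K) ≠ 0) (h3' : (3 : AlgebraicClosure K) ≠ 0) :
    IsDiscriminant K 2 (pullback K 2 (weierstrassDisc K)) := by
  have h6912 : (6912 : AlgebraicClosure K) ≠ 0 := by
    rw [show (6912 : AlgebraicClosure K) = 2 ^ 8 * 3 ^ 3 by norm_num]
    positivity
  have h108 : (108 : AlgebraicClosure K) ≠ 0 := by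
    rw [show (108 : AlgebraicClosure K) = 2 ^ 2 * 3 ^ 3 by norm_num]
    positivity
  have hsing (φ : Fin 8 → AlgebraicClosure K) :
      (∃ P : Fin 3 → AlgebraicClosure K, ¬(P 0 = 0 ∧ P 1 = 0) ∧
        IsSingularZero (doubleCoverForm φ) P) ↔
      weierstrassMap₂ K φ 0 ^ 3 - 27 * weierstrassMap₂ K φ 1 ^ 2 = 0 := by
    rw [exists_isSingularZero_doubleCoverForm_iff_quarticDisc h2' h3', weierstrassMap₂,
      ← mul_eq_zero_iff_left (b := _ - _) h6912, quarticDisc_eq h2 h3]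
    simp only [Algebra.smul_def, map_inv₀, map_ofNat]
  -- The family `y² = z(x + z)(x² - tz²)`.
  refine isDiscriminant_pullback h2 2 hsing
    (fun i => singularModel₂ X i) (fun φ => ?_)
    ![0, 0, 0, 0, 1, 1, -Polynomial.X, -Polynomial.X] (weierstrassMap₂ K _) rfl 6912 h6912
    (108 * (1 - Polynomial.X) ^ 2) (by simpa using h108) ?_
  · refine (exists_isSingularZero_doubleCoverForm_iff h2' φ).trans (exists_congr fun t => ?_)
    exact forall_congr' fun i => by rw [← eval_singularModel₂]
  · rw [map_ofNat]
    refine (quarticDisc_eq h2 h3 _ _ _ _ _).trans ?_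
    rw [← quarticDisc_line]
    simp

/-! ### Invariance of the Aronhold invariants -/

section Aronhold

/-- The ternary cubic `ax³ + by³ + cz³ + 3a₂x²y + 3a₃x²z + 3b₁xy² + 3b₃y²z + 3c₁xz² + 3c₂yz²
+ 6mxyz` as a model of degree 3, from its classical coefficients
`(a, b, c, a₂, a₃, b₁, b₃, c₁, c₂, m)`. -/
def classicalCubic {R : Type*} [CommRing R] (t : Fin 10 → R) : Fin 10 → R :=
  ![t 0, t 1, t 2, 3 * t 3, 3 * t 4, 3 * t 5, 3 * t 6, 3 * t 7, 3 * t 8, 6 * t 9]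

/-- Classical coefficients of the cubic obtained by exchanging `x` and `y`. -/
def swapXY {R : Type*} (t : Fin 10 → R) : Fin 10 → R :=
  ![t 1, t 0, t 2, t 5, t 6, t 3, t 4, t 8, t 7, t 9]

/-- Classical coefficients of the cubic obtained by exchanging `x` and `z`. -/
def swapXZ {R : Type*} (t : Fin 10 → R) : Fin 10 → R :=
  ![t 2, t 1, t 0, t 8, t 7, t 6, t 5, t 4, t 3, t 9]

/-- Classical coefficients of the cubic obtained by substituting `x + rz` for `x`. -/
def shiftX {R : Type*} [CommRing R] (r : R) (t : Fin 10 → R) : Fin 10 → R :=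
  ![t 0, t 1, t 2 + 3 * r * t 7 + 3 * r ^ 2 * t 4 + r ^ 3 * t 0, t 3, t 4 + r * t 0, t 5,
    t 6 + r * t 5, t 7 + 2 * r * t 4 + r ^ 2 * t 0, t 8 + 2 * r * t 9 + r ^ 2 * t 3,
    t 9 + r * t 3]

variable {K A : Type*} [Field K] [CommRing A] [Algebra K A]

theorem inv_smul_ofNat_mul {k : ℕ} [k.AtLeastTwo] (hk : (OfNat.ofNat k : K) ≠ 0) (x : A) :
    (OfNat.ofNat k : K)⁻¹ • (OfNat.ofNat k * x) = x := by
  rw [← map_ofNat (algebraMap K A), ← Algebra.smul_def, smul_smul, inv_mul_cancel₀ hk, one_smul]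

theorem cubicS_swapXY (h3 : (3 : K) ≠ 0) (h6 : (6 : K) ≠ 0) (t : Fin 10 → A) :
    cubicS K (classicalCubic (swapXY t)) = cubicS K (classicalCubic t) := by
  simp only [cubicS, classicalCubic, swapXY, Matrix.cons_val, inv_smul_ofNat_mul h3,
    inv_smul_ofNat_mul h6]
  ring

theorem cubicS_swapXZ (h3 : (3 : K) ≠ 0) (h6 : (6 : K) ≠ 0) (t : Fin 10 → A) :
    cubicS K (classicalCubic (swapXZ t)) = cubicS K (classicalCubic t) := by
  simp only [cubicS, classicalCubic, swapXZ, Matrix.cons_val, inv_smul_ofNat_mul h3,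
    inv_smul_ofNat_mul h6]
  ring

theorem cubicS_shiftX (h3 : (3 : K) ≠ 0) (h6 : (6 : K) ≠ 0) (r : A) (t : Fin 10 → A) :
    cubicS K (classicalCubic (shiftX r t)) = cubicS K (classicalCubic t) := by
  simp only [cubicS, classicalCubic, shiftX, Matrix.cons_val, inv_smul_ofNat_mul h3,
    inv_smul_ofNat_mul h6]
  ring

theorem cubicT_swapXY (h3 : (3 : K) ≠ 0) (h6 : (6 : K) ≠ 0) (t : Fin 10 → A) :
    cubicT K (classicalCubic (swapXY t)) = cubicT K (classicalCubic t) := by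
  simp only [cubicT, classicalCubic, swapXY, Matrix.cons_val, inv_smul_ofNat_mul h3,
    inv_smul_ofNat_mul h6]
  ring

theorem cubicT_swapXZ (h3 : (3 : K) ≠ 0) (h6 : (6 : K) ≠ 0) (t : Fin 10 → A) :
    cubicT K (classicalCubic (swapXZ t)) = cubicT K (classicalCubic t) := by
  simp only [cubicT, classicalCubic, swapXZ, Matrix.cons_val, inv_smul_ofNat_mul h3,
    inv_smul_ofNat_mul h6]
  ring

theorem cubicT_shiftX (h3 : (3 : K) ≠ 0) (h6 : (6 : K) ≠ 0) (r : A) (t : Fin 10 → A) :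
    cubicT K (classicalCubic (shiftX r t)) = cubicT K (classicalCubic t) := by
  simp only [cubicT, classicalCubic, shiftX, Matrix.cons_val, inv_smul_ofNat_mul h3,
    inv_smul_ofNat_mul h6]
  ring

/-- The quartic `(Q² - 4LC) / 3` attached to a cubic `z²L(x, y) + zQ(x, y) + C(x, y)` through the
point `(0 : 0 : 1)`; projecting from this point presents the curve as the double cover
`w² = Q² - 4LC` of the line. The invariants of the cubic are those of this quartic, up to
constants. -/
theorem quarticDisc_projection (h3 : (3 : K) ≠ 0) (h6 : (6 : K) ≠ 0) (t : Fin 10 → A)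
    (hc : t 2 = 0) :
    256 * (weierstrassMap₃ K (classicalCubic t) 0 ^ 3
        - 27 * weierstrassMap₃ K (classicalCubic t) 1 ^ 2) =
      27 * quarticDisc (3 * t 4 ^ 2 - 4 * t 7 * t 0)
        (12 * t 4 * t 9 - 4 * (3 * t 7 * t 3 + t 8 * t 0))
        (3 * (4 * t 9 ^ 2 + 2 * t 4 * t 6) - 12 * (t 7 * t 5 + t 8 * t 3))
        (12 * t 9 * t 6 - 4 * (t 7 * t 1 + 3 * t 8 * t 5))
        (3 * t 6 ^ 2 - 4 * t 8 * t 1) := by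
  have hI : 12 * (3 * t 4 ^ 2 - 4 * t 7 * t 0) * (3 * t 6 ^ 2 - 4 * t 8 * t 1)
      - 3 * (12 * t 4 * t 9 - 4 * (3 * t 7 * t 3 + t 8 * t 0))
        * (12 * t 9 * t 6 - 4 * (t 7 * t 1 + 3 * t 8 * t 5))
      + (3 * (4 * t 9 ^ 2 + 2 * t 4 * t 6) - 12 * (t 7 * t 5 + t 8 * t 3)) ^ 2
      = -144 * cubicS K (classicalCubic t) := by
    simp only [cubicS, classicalCubic, Matrix.cons_val, inv_smul_ofNat_mul h3,
      inv_smul_ofNat_mul h6, hc]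
    ring
  have hJ : 72 * (3 * t 4 ^ 2 - 4 * t 7 * t 0)
        * (3 * (4 * t 9 ^ 2 + 2 * t 4 * t 6) - 12 * (t 7 * t 5 + t 8 * t 3))
        * (3 * t 6 ^ 2 - 4 * t 8 * t 1)
      - 27 * (3 * t 4 ^ 2 - 4 * t 7 * t 0)
        * (12 * t 9 * t 6 - 4 * (t 7 * t 1 + 3 * t 8 * t 5)) ^ 2
      - 27 * (12 * t 4 * t 9 - 4 * (3 * t 7 * t 3 + t 8 * t 0)) ^ 2
        * (3 * t 6 ^ 2 - 4 * t 8 * t 1)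
      + 9 * (12 * t 4 * t 9 - 4 * (3 * t 7 * t 3 + t 8 * t 0))
        * (3 * (4 * t 9 ^ 2 + 2 * t 4 * t 6) - 12 * (t 7 * t 5 + t 8 * t 3))
        * (12 * t 9 * t 6 - 4 * (t 7 * t 1 + 3 * t 8 * t 5))
      - 2 * (3 * (4 * t 9 ^ 2 + 2 * t 4 * t 6) - 12 * (t 7 * t 5 + t 8 * t 3)) ^ 3
      = 432 * cubicT K (classicalCubic t) := by
    simp only [cubicT, classicalCubic, Matrix.cons_val, inv_smul_ofNat_mul h3,
      inv_smul_ofNat_mul h6, hc]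
    ring
  rw [quarticDisc, hI, hJ]
  simp only [weierstrassMap₃, Matrix.cons_val_zero, Matrix.cons_val_one, Matrix.cons_val_fin_one]
  ring

/-- The discriminant of the cubic `3 (y²z - x³ - x²z + uxz² + uz³)`. -/
theorem weierstrassMap₃_line (h3 : (3 : K) ≠ 0) (h6 : (6 : K) ≠ 0) (u : A) :
    weierstrassMap₃ K (classicalCubic ![-3, 0, 3 * u, 0, -1, 0, 1, u, 0, 0]) 0 ^ 3
        - 27 * weierstrassMap₃ K (classicalCubic ![-3, 0, 3 * u, 0, -1, 0, 1, u, 0, 0]) 1 ^ 2 =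
      u * (34012224 * (1 - u) ^ 2) := by
  simp only [weierstrassMap₃, cubicS, cubicT, classicalCubic, Matrix.cons_val,
    inv_smul_ofNat_mul h3, inv_smul_ofNat_mul h6]
  ring

end Aronhold

/-! ### Singular points of ternary cubics -/

section CubicPoints

/-- The point `(x : y : z)` is a singular point of the cubic with classical coefficients `t`: its
partial derivatives, divided by `3`, vanish there. -/
def IsCubicNode {R : Type*} [CommRing R] (t : Fin 10 → R) (x y z : R) : Prop :=
  t 0 * x ^ 2 + 2 * t 3 * x * y + 2 * t 4 * x * z + t 5 * y ^ 2 + 2 * t 9 * y * z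
    + t 7 * z ^ 2 = 0 ∧
  t 3 * x ^ 2 + 2 * t 5 * x * y + 2 * t 9 * x * z + t 1 * y ^ 2 + 2 * t 6 * y * z
    + t 8 * z ^ 2 = 0 ∧
  t 4 * x ^ 2 + 2 * t 9 * x * y + 2 * t 7 * x * z + t 6 * y ^ 2 + 2 * t 8 * y * z
    + t 2 * z ^ 2 = 0

variable {R : Type*} [CommRing R]

theorem isCubicNode_swapXY (t : Fin 10 → R) (x y z : R) :
    IsCubicNode (swapXY t) x y z ↔ IsCubicNode t y x z := by
  simp only [IsCubicNode, swapXY, Matrix.cons_val]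
  constructor <;> rintro ⟨h0, h1, h2⟩ <;>
    exact ⟨by linear_combination h1, by linear_combination h0, by linear_combination h2⟩

theorem isCubicNode_swapXZ (t : Fin 10 → R) (x y z : R) :
    IsCubicNode (swapXZ t) x y z ↔ IsCubicNode t z y x := by
  simp only [IsCubicNode, swapXZ, Matrix.cons_val]
  constructor <;> rintro ⟨h0, h1, h2⟩ <;>
    exact ⟨by linear_combination h2, by linear_combination h1, by linear_combination h0⟩

theorem isCubicNode_shiftX (r : R) (t : Fin 10 → R) (x y z : R) :
    IsCubicNode (shiftX r t) x y z ↔ IsCubicNode t (x + r * z) y z := by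
  simp only [IsCubicNode, shiftX, Matrix.cons_val]
  constructor <;> rintro ⟨h0, h1, h2⟩
  · exact ⟨by linear_combination h0, by linear_combination h1, by linear_combination h2 - r * h0⟩
  · exact ⟨by linear_combination h0, by linear_combination h1, by linear_combination h2 + r * h0⟩

theorem isSingularZero_cubicForm_iff {F : Type*} [Field F] (h3 : (3 : F) ≠ 0) (t : Fin 10 → F)
    (P : Fin 3 → F) :
    IsSingularZero (cubicForm (classicalCubic t)) P ↔ IsCubicNode t (P 0) (P 1) (P 2) := by
  have e0 : eval P (cubicForm (classicalCubic t)) =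
      P 0 * (t 0 * P 0 ^ 2 + 2 * t 3 * P 0 * P 1 + 2 * t 4 * P 0 * P 2 + t 5 * P 1 ^ 2
        + 2 * t 9 * P 1 * P 2 + t 7 * P 2 ^ 2)
      + P 1 * (t 3 * P 0 ^ 2 + 2 * t 5 * P 0 * P 1 + 2 * t 9 * P 0 * P 2 + t 1 * P 1 ^ 2
        + 2 * t 6 * P 1 * P 2 + t 8 * P 2 ^ 2)
      + P 2 * (t 4 * P 0 ^ 2 + 2 * t 9 * P 0 * P 1 + 2 * t 7 * P 0 * P 2 + t 6 * P 1 ^ 2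
        + 2 * t 8 * P 1 * P 2 + t 2 * P 2 ^ 2) := by
    simp [cubicForm, classicalCubic, map_ofNat]
    ring
  have e1 : eval P (pderiv 0 (cubicForm (classicalCubic t))) =
      3 * (t 0 * P 0 ^ 2 + 2 * t 3 * P 0 * P 1 + 2 * t 4 * P 0 * P 2 + t 5 * P 1 ^ 2
        + 2 * t 9 * P 1 * P 2 + t 7 * P 2 ^ 2) := by
    simp [cubicForm, pderiv_X]
    simp [classicalCubic]
    ring
  have e2 : eval P (pderiv 1 (cubicForm (classicalCubic t))) =
      3 * (t 3 * P 0 ^ 2 + 2 * t 5 * P 0 * P 1 + 2 * t 9 * P 0 * P 2 + t 1 * P 1 ^ 2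
        + 2 * t 6 * P 1 * P 2 + t 8 * P 2 ^ 2) := by
    simp [cubicForm, pderiv_X]
    simp [classicalCubic]
    ring
  have e3 : eval P (pderiv 2 (cubicForm (classicalCubic t))) =
      3 * (t 4 * P 0 ^ 2 + 2 * t 9 * P 0 * P 1 + 2 * t 7 * P 0 * P 2 + t 6 * P 1 ^ 2
        + 2 * t 8 * P 1 * P 2 + t 2 * P 2 ^ 2) := by
    simp [cubicForm, pderiv_X]
    simp [classicalCubic]
    ring
  simp only [IsSingularZero, Fin.forall_fin_succ, IsEmpty.forall_iff, and_true,
    Fin.succ_zero_eq_one, Fin.succ_one_eq_two, e0, e1, e2, e3, mul_eq_zero_iff_left h3,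
    IsCubicNode]
  refine ⟨And.right, fun h => ⟨?_, h⟩⟩
  rw [h.1, h.2.1, h.2.2]
  ring

end CubicPoints

section CubicDiscriminant

variable {K F : Type*} [Field K] [Field F] [Algebra K F]

theorem exists_move_point_of_ne_zero (h3 : (3 : K) ≠ 0) (h6 : (6 : K) ≠ 0) (t : Fin 10 → F)
    (x y z : F) (hz : z ≠ 0) :
    ∃ t' : Fin 10 → F, cubicS K (classicalCubic t') = cubicS K (classicalCubic t) ∧
      cubicT K (classicalCubic t') = cubicT K (classicalCubic t) ∧
      ((∃ x y z, (x ≠ 0 ∨ y ≠ 0 ∨ z ≠ 0) ∧ IsCubicNode t' x y z) →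
        ∃ x y z, (x ≠ 0 ∨ y ≠ 0 ∨ z ≠ 0) ∧ IsCubicNode t x y z) ∧
      (t 0 * x ^ 3 + t 1 * y ^ 3 + t 2 * z ^ 3 + 3 * t 3 * x ^ 2 * y + 3 * t 4 * x ^ 2 * z
        + 3 * t 5 * x * y ^ 2 + 3 * t 6 * y ^ 2 * z + 3 * t 7 * x * z ^ 2 + 3 * t 8 * y * z ^ 2
        + 6 * t 9 * x * y * z = 0 → t' 2 = 0) ∧
      (IsCubicNode t x y z → IsCubicNode t' 0 0 1) := by
  obtain ⟨r, rfl⟩ : ∃ r, x = r * z := ⟨x / z, by field_simp⟩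
  obtain ⟨s, rfl⟩ : ∃ s, y = s * z := ⟨y / z, by field_simp⟩
  refine ⟨swapXY (shiftX s (swapXY (shiftX r t))), ?_, ?_, ?_, fun h => ?_, ?_⟩
  · rw [cubicS_swapXY h3 h6, cubicS_shiftX h3 h6, cubicS_swapXY h3 h6, cubicS_shiftX h3 h6]
  · rw [cubicT_swapXY h3 h6, cubicT_shiftX h3 h6, cubicT_swapXY h3 h6, cubicT_shiftX h3 h6]
  · simp only [isCubicNode_swapXY, isCubicNode_shiftX]
    rintro ⟨x, y, w, h, hn⟩
    refine ⟨_, _, _, ?_, hn⟩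
    by_cases hw : w = 0
    · simpa [hw] using h
    · exact Or.inr (Or.inr hw)
  · simp only [swapXY, shiftX, Matrix.cons_val]
    apply mul_left_cancel₀ (pow_ne_zero 3 hz)
    linear_combination h
  · simp only [isCubicNode_swapXY, isCubicNode_shiftX]
    rintro ⟨h0, h1, h2⟩
    refine ⟨?_, ?_, ?_⟩ <;> apply mul_left_cancel₀ (pow_ne_zero 2 hz)
    · linear_combination h0
    · linear_combination h1
    · linear_combination h2

/-- A cubic can be moved by a linear substitution, which does not change `S` and `T`, so that a
given point becomes `(0 : 0 : 1)`. The substitution is a composition of shifts and permutations of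
the coordinates. -/
theorem exists_move_point (h3 : (3 : K) ≠ 0) (h6 : (6 : K) ≠ 0) (t : Fin 10 → F) (x y z : F)
    (hP : x ≠ 0 ∨ y ≠ 0 ∨ z ≠ 0) :
    ∃ t' : Fin 10 → F, cubicS K (classicalCubic t') = cubicS K (classicalCubic t) ∧
      cubicT K (classicalCubic t') = cubicT K (classicalCubic t) ∧
      ((∃ x y z, (x ≠ 0 ∨ y ≠ 0 ∨ z ≠ 0) ∧ IsCubicNode t' x y z) →
        ∃ x y z, (x ≠ 0 ∨ y ≠ 0 ∨ z ≠ 0) ∧ IsCubicNode t x y z) ∧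
      (t 0 * x ^ 3 + t 1 * y ^ 3 + t 2 * z ^ 3 + 3 * t 3 * x ^ 2 * y + 3 * t 4 * x ^ 2 * z
        + 3 * t 5 * x * y ^ 2 + 3 * t 6 * y ^ 2 * z + 3 * t 7 * x * z ^ 2 + 3 * t 8 * y * z ^ 2
        + 6 * t 9 * x * y * z = 0 → t' 2 = 0) ∧
      (IsCubicNode t x y z → IsCubicNode t' 0 0 1) := by
  by_cases hz : z = 0
  · by_cases hy : y = 0
    · have hx : x ≠ 0 := by simpa [hz, hy] using hP
      obtain ⟨t', hS, hT, hs, he, hn⟩ := exists_move_point_of_ne_zero h3 h6 (swapXZ t) z y x hx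
      rw [cubicS_swapXZ h3 h6] at hS
      rw [cubicT_swapXZ h3 h6] at hT
      simp only [isCubicNode_swapXZ] at hs hn
      refine ⟨t', hS, hT, fun h => ?_, fun h => he ?_, hn⟩
      · obtain ⟨x, y, z, h, hn⟩ := hs h
        exact ⟨z, y, x, by rcases h with h | h | h <;> simp [h], hn⟩
      · simp only [swapXZ, Matrix.cons_val]
        linear_combination h
    · obtain ⟨t', hS, hT, hs, he, hn⟩ :=
        exists_move_point_of_ne_zero h3 h6 (swapXZ (swapXY t)) z x y hy
      rw [cubicS_swapXZ h3 h6, cubicS_swapXY h3 h6] at hS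
      rw [cubicT_swapXZ h3 h6, cubicT_swapXY h3 h6] at hT
      simp only [isCubicNode_swapXZ, isCubicNode_swapXY] at hs hn
      refine ⟨t', hS, hT, fun h => ?_, fun h => he ?_, hn⟩
      · obtain ⟨x, y, z, h, hn⟩ := hs h
        exact ⟨y, z, x, by rcases h with h | h | h <;> simp [h], hn⟩
      · simp only [swapXZ, swapXY, Matrix.cons_val]
        linear_combination h
  · exact exists_move_point_of_ne_zero h3 h6 t x y z hz

/-- A singular point at `(0 : 0 : 1)` makes the discriminant vanish. -/
theorem weierstrassMap₃_disc_eq_zero_of_isCubicNode (h3 : (3 : K) ≠ 0) (h6 : (6 : K) ≠ 0)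
    (h2' : (2 : F) ≠ 0) {t : Fin 10 → F} (h : IsCubicNode t 0 0 1) :
    weierstrassMap₃ K (classicalCubic t) 0 ^ 3
      - 27 * weierstrassMap₃ K (classicalCubic t) 1 ^ 2 = 0 := by
  simp [IsCubicNode] at h
  have h256 : (256 : F) ≠ 0 := by
    rw [show (256 : F) = 2 ^ 8 by norm_num]
    positivity
  apply mul_left_cancel₀ h256
  rw [quarticDisc_projection h3 h6 t h.2.2, h.1, h.2.1, quarticDisc]
  ring

/-- A cubic through `(0 : 0 : 1)` with vanishing discriminant has a singular point, which lies over
a double zero `(r, s)` of the quartic `(Q² - 4LC) / 3`, unless `L = 0` and `(0 : 0 : 1)` is itself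
singular. If the nonzero form `L` vanishes at `(r, s)`, then so do `Q` and `C`, the line through
`(0 : 0 : 1)` and `(r : s : 0)` is a component, and the singular point is an intersection of this
line with the residual conic. -/
theorem exists_isCubicNode_of_disc_eq_zero [IsAlgClosed F] (h3 : (3 : K) ≠ 0) (h6 : (6 : K) ≠ 0)
    (h2' : (2 : F) ≠ 0) (h3' : (3 : F) ≠ 0) {t : Fin 10 → F} (hc : t 2 = 0)
    (h : weierstrassMap₃ K (classicalCubic t) 0 ^ 3
      - 27 * weierstrassMap₃ K (classicalCubic t) 1 ^ 2 = 0) :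
    ∃ x y z, (x ≠ 0 ∨ y ≠ 0 ∨ z ≠ 0) ∧ IsCubicNode t x y z := by
  have h4 : (4 : F) ≠ 0 := by
    rw [show (4 : F) = 2 ^ 2 by norm_num]
    exact pow_ne_zero _ h2'
  have h27 : (27 : F) ≠ 0 := by
    rw [show (27 : F) = 3 ^ 3 by norm_num]
    exact pow_ne_zero _ h3'
  have hd := quarticDisc_projection h3 h6 t hc
  rw [h, mul_zero, eq_comm, mul_eq_zero_iff_left h27, quarticDisc_eq_zero_iff h2' h3'] at hd
  obtain ⟨r, s, hrs, hx, hz⟩ := hd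
  -- The values at `(r, s)` of `L / 3`, `Q / 3` and `C`, and of the partial derivatives of the
  -- last two, divided by `2` and by `3`.
  obtain ⟨L, hL⟩ : ∃ L, L = t 7 * r + t 8 * s := ⟨_, rfl⟩
  obtain ⟨Q, hQ⟩ : ∃ Q, Q = t 4 * r ^ 2 + 2 * t 9 * r * s + t 6 * s ^ 2 := ⟨_, rfl⟩
  obtain ⟨C, hC⟩ : ∃ C, C = t 0 * r ^ 3 + 3 * t 3 * r ^ 2 * s + 3 * t 5 * r * s ^ 2
    + t 1 * s ^ 3 := ⟨_, rfl⟩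
  obtain ⟨Qx, hQx⟩ : ∃ Qx, Qx = t 4 * r + t 9 * s := ⟨_, rfl⟩
  obtain ⟨Qy, hQy⟩ : ∃ Qy, Qy = t 9 * r + t 6 * s := ⟨_, rfl⟩
  obtain ⟨Cx, hCx⟩ : ∃ Cx, Cx = t 0 * r ^ 2 + 2 * t 3 * r * s + t 5 * s ^ 2 := ⟨_, rfl⟩
  obtain ⟨Cy, hCy⟩ : ∃ Cy, Cy = t 3 * r ^ 2 + 2 * t 5 * r * s + t 1 * s ^ 2 := ⟨_, rfl⟩
  have hx' : 3 * Q * Qx - t 7 * C - 3 * L * Cx = 0 := by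
    apply mul_left_cancel₀ h4
    rw [hQ, hQx, hC, hCx, hL]
    linear_combination hx
  have hy' : 3 * Q * Qy - t 8 * C - 3 * L * Cy = 0 := by
    apply mul_left_cancel₀ h4
    rw [hQ, hQy, hC, hCy, hL]
    linear_combination hz
  have eL : t 7 * r + t 8 * s = L := hL.symm
  have eQ : r * Qx + s * Qy = Q := by rw [hQx, hQy, hQ]; ring
  have eC : r * Cx + s * Cy = C := by rw [hCx, hCy, hC]; ring
  have hnode (z w : F) : IsCubicNode t (r * w) (s * w) z ↔
      t 7 * z ^ 2 + 2 * Qx * z * w + Cx * w ^ 2 = 0 ∧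
      t 8 * z ^ 2 + 2 * Qy * z * w + Cy * w ^ 2 = 0 ∧ w * (2 * L * z + Q * w) = 0 := by
    rw [IsCubicNode, hc, hQx, hQy, hCx, hCy, hL, hQ]
    refine and_congr (Eq.congr_left ?_) (and_congr (Eq.congr_left ?_) (Eq.congr_left ?_)) <;> ring
  clear hQ hC hQx hQy hCx hCy hL
  have hG : 3 * Q ^ 2 - 4 * L * C = 0 := by
    linear_combination r * hx' + s * hy' - 3 * Q * eQ + C * eL + 3 * L * eC
  by_cases hL0 : L = 0
  · have hQ0 : Q = 0 := by
      have : 3 * Q ^ 2 = 0 := by rw [← hG, hL0]; ring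
      simpa [h3'] using this
    by_cases h78 : t 7 = 0 ∧ t 8 = 0
    · exact ⟨0, 0, 1, by simp, by simp [IsCubicNode, h78, hc]⟩
    have hC0 : C = 0 := by
      rw [hL0, hQ0] at hx' hy'
      by_contra hC0
      refine h78 ⟨?_, ?_⟩ <;> apply mul_right_cancel₀ hC0
      · linear_combination -hx'
      · linear_combination -hy'
    rcases hrs with hr | hs
    · obtain ⟨z, w, hzw, h0⟩ := exists_quadratic_zero (t 8) (2 * Qy) Cy
      refine ⟨r * w, s * w, z, ?_, (hnode z w).mpr ⟨?_, h0, by rw [hL0, hQ0]; ring⟩⟩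
      · rcases hzw with hz | hw
        · exact Or.inr (Or.inr hz)
        · exact Or.inl (mul_ne_zero hr hw)
      · apply mul_left_cancel₀ hr
        linear_combination -s * h0 + z ^ 2 * (eL + hL0) + 2 * z * w * (eQ + hQ0)
          + w ^ 2 * (eC + hC0)
    · obtain ⟨z, w, hzw, h0⟩ := exists_quadratic_zero (t 7) (2 * Qx) Cx
      refine ⟨r * w, s * w, z, ?_, (hnode z w).mpr ⟨h0, ?_, by rw [hL0, hQ0]; ring⟩⟩
      · rcases hzw with hz | hw
        · exact Or.inr (Or.inr hz)
        · exact Or.inr (Or.inl (mul_ne_zero hs hw))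
      · apply mul_left_cancel₀ hs
        linear_combination -r * h0 + z ^ 2 * (eL + hL0) + 2 * z * w * (eQ + hQ0)
          + w ^ 2 * (eC + hC0)
  · have hw : 2 * L ≠ 0 := mul_ne_zero h2' hL0
    refine ⟨r * (2 * L), s * (2 * L), -Q, ?_, (hnode _ _).mpr ⟨?_, ?_, by ring⟩⟩
    · rcases hrs with hr | hs
      · exact Or.inl (mul_ne_zero hr hw)
      · exact Or.inr (Or.inl (mul_ne_zero hs hw))
    · apply mul_left_cancel₀ h3'
      linear_combination t 7 * hG - 4 * L * hx'
    · apply mul_left_cancel₀ h3'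
      linear_combination t 8 * hG - 4 * L * hy'

/-- A ternary cubic is singular if and only if `g₂³ - 27g₃²` vanishes for it. -/
theorem exists_isSingularZero_cubicForm_iff [IsAlgClosed F] (h3 : (3 : K) ≠ 0) (h6 : (6 : K) ≠ 0)
    (h2' : (2 : F) ≠ 0) (h3' : (3 : F) ≠ 0) (t : Fin 10 → F) :
    (∃ P : Fin 3 → F, P ≠ 0 ∧ IsSingularZero (cubicForm (classicalCubic t)) P) ↔
      weierstrassMap₃ K (classicalCubic t) 0 ^ 3
        - 27 * weierstrassMap₃ K (classicalCubic t) 1 ^ 2 = 0 := by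
  have hnode : (∃ P : Fin 3 → F, P ≠ 0 ∧ IsSingularZero (cubicForm (classicalCubic t)) P) ↔
      ∃ x y z, (x ≠ 0 ∨ y ≠ 0 ∨ z ≠ 0) ∧ IsCubicNode t x y z := by
    simp only [isSingularZero_cubicForm_iff h3']
    constructor
    · rintro ⟨P, hP, h⟩
      refine ⟨P 0, P 1, P 2, ?_, h⟩
      by_contra! h0
      exact hP (by ext i; fin_cases i <;> simp [h0])
    · rintro ⟨x, y, z, h0, h⟩
      refine ⟨![x, y, z], fun hP => ?_, h⟩
      have hx := congrFun hP 0
      have hy := congrFun hP 1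
      have hz := congrFun hP 2
      simp at hx hy hz
      tauto
  rw [hnode]
  have hdisc {t' : Fin 10 → F} (hS : cubicS K (classicalCubic t') = cubicS K (classicalCubic t))
      (hT : cubicT K (classicalCubic t') = cubicT K (classicalCubic t)) :
      weierstrassMap₃ K (classicalCubic t') = weierstrassMap₃ K (classicalCubic t) := by
    rw [weierstrassMap₃, hS, hT, weierstrassMap₃]
  constructor
  · rintro ⟨x, y, z, hP, h⟩
    obtain ⟨t', hS, hT, -, -, hn⟩ := exists_move_point h3 h6 t x y z hP
    rw [← hdisc hS hT]
    exact weierstrassMap₃_disc_eq_zero_of_isCubicNode h3 h6 h2' (hn h)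
  · intro h
    obtain ⟨x, y, hxy, h0⟩ := exists_cubic_zero (t 0) (3 * t 3) (3 * t 5) (t 1)
    obtain ⟨t', hS, hT, hs, he, -⟩ := exists_move_point h3 h6 t x y 0
      (by rcases hxy with h | h <;> simp [h])
    rw [← hdisc hS hT] at h
    exact hs (exists_isCubicNode_of_disc_eq_zero h3 h6 h2' h3'
      (he (by linear_combination h0)) h)

end CubicDiscriminant
/-! ### The parametrization of singular cubics -/

section CubicParam

/-- The symmetric trilinear form `f` with `f(x, x, x)` the cubic form with classical
coefficients `t`. -/
def cubicPolar {R : Type*} [CommRing R] (t : Fin 10 → R) (u v w : Fin 3 → R) : R :=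
  t 0 * u 0 * v 0 * w 0 + t 1 * u 1 * v 1 * w 1 + t 2 * u 2 * v 2 * w 2
    + t 3 * (u 0 * v 0 * w 1 + u 0 * v 1 * w 0 + u 1 * v 0 * w 0)
    + t 4 * (u 0 * v 0 * w 2 + u 0 * v 2 * w 0 + u 2 * v 0 * w 0)
    + t 5 * (u 0 * v 1 * w 1 + u 1 * v 0 * w 1 + u 1 * v 1 * w 0)
    + t 6 * (u 1 * v 1 * w 2 + u 1 * v 2 * w 1 + u 2 * v 1 * w 1)
    + t 7 * (u 0 * v 2 * w 2 + u 2 * v 0 * w 2 + u 2 * v 2 * w 0)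
    + t 8 * (u 1 * v 2 * w 2 + u 2 * v 1 * w 2 + u 2 * v 2 * w 1)
    + t 9 * (u 0 * v 1 * w 2 + u 0 * v 2 * w 1 + u 1 * v 0 * w 2 + u 1 * v 2 * w 0
      + u 2 * v 0 * w 1 + u 2 * v 1 * w 0)

/-- The classical coefficients of the cubic form of a trilinear form `f`, which are its values at
unit vectors. -/
def cubicOfPolar {R : Type*} (f : Fin 3 → Fin 3 → Fin 3 → R) : Fin 10 → R :=
  ![f 0 0 0, f 1 1 1, f 2 2 2, f 0 0 1, f 0 0 2, f 0 1 1, f 1 1 2, f 0 2 2, f 1 2 2, f 0 1 2]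

/-- The columns of the matrix of the linear map `x ↦ ℓ(P)x - ℓ(x)P`, where `ℓ` is the linear form
with coefficients `l`. It kills `P`. -/
def killMap {R : Type*} [CommRing R] {n : ℕ} (P l : Fin n → R) (i : Fin n) : Fin n → R :=
  fun j => (∑ k, l k * P k) * (if j = i then 1 else 0) - l i * P j

/-- Classical coefficients of the cubic `g(Tx, Tx, Tx) + 3ℓ(x)g(Tx, Tx, P)`, where
`Tx = ℓ(P)x - ℓ(x)P` and `g` is the symmetric trilinear form of a cubic. If `ℓ(P) = 1`, then
`x = Tx + ℓ(x)P`, so this is the cubic of `g` without the terms that obstruct a singularity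
at `P`. -/
def nodalCubic {R : Type*} [CommRing R] (P l : Fin 3 → R) (g : Fin 10 → R) : Fin 10 → R :=
  cubicOfPolar fun i j k =>
    cubicPolar g (killMap P l i) (killMap P l j) (killMap P l k)
      + l i * cubicPolar g (killMap P l j) (killMap P l k) P
      + l j * cubicPolar g (killMap P l i) (killMap P l k) P
      + l k * cubicPolar g (killMap P l i) (killMap P l j) P

/-- The cubics that are singular at a point `P`, for the parameters `P`, `ℓ`, `g` of
`nodalCubic`. -/
def singularModel₃ {R : Type*} [CommRing R] (t : Fin 3 ⊕ Fin 3 ⊕ Fin 10 → R) : Fin 10 → R :=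
  classicalCubic (nodalCubic (t ∘ Sum.inl) (t ∘ Sum.inr ∘ Sum.inl) (t ∘ Sum.inr ∘ Sum.inr))

theorem map_cubicPolar {R S : Type*} [CommRing R] [CommRing S] (f : R →+* S) (t : Fin 10 → R)
    (u v w : Fin 3 → R) : f (cubicPolar t u v w) = cubicPolar (f ∘ t) (f ∘ u) (f ∘ v) (f ∘ w) := by
  simp [cubicPolar]

theorem comp_killMap {R S : Type*} [CommRing R] [CommRing S] (f : R →+* S) {n : ℕ}
    (P l : Fin n → R) (i : Fin n) : f ∘ killMap P l i = killMap (f ∘ P) (f ∘ l) i := by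
  ext j
  simp [killMap, apply_ite f]

theorem eval_singularModel₃ {R : Type*} [CommRing R] (t : Fin 3 ⊕ Fin 3 ⊕ Fin 10 → R)
    (i : Fin 10) : eval t (singularModel₃ X i) = singularModel₃ t i := by
  have hinl : (eval t ∘ (X ∘ Sum.inl) : Fin 3 → R) = t ∘ Sum.inl := by ext; simp
  have hinr : (eval t ∘ (X ∘ Sum.inr ∘ Sum.inl) : Fin 3 → R) = t ∘ Sum.inr ∘ Sum.inl := by
    ext; simp
  have hg : (eval t ∘ (X ∘ Sum.inr ∘ Sum.inr) : Fin 10 → R) = t ∘ Sum.inr ∘ Sum.inr := by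
    ext; simp
  fin_cases i <;>
    simp only [singularModel₃, classicalCubic, nodalCubic, cubicOfPolar, Fin.zero_eta, Fin.mk_one,
      Fin.reduceFinMk, Matrix.cons_val, map_mul, map_add, map_ofNat, map_cubicPolar, comp_killMap,
      hinl, hinr, hg, Function.comp, eval_X]

theorem isCubicNode_iff_cubicPolar {R : Type*} [CommRing R] (t : Fin 10 → R) (P : Fin 3 → R) :
    IsCubicNode t (P 0) (P 1) (P 2) ↔ ∀ w, cubicPolar t P P w = 0 := by
  constructor
  · rintro ⟨h0, h1, h2⟩ w
    rw [cubicPolar]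
    linear_combination w 0 * h0 + w 1 * h1 + w 2 * h2
  · intro h
    have h0 := h ![1, 0, 0]
    have h1 := h ![0, 1, 0]
    have h2 := h ![0, 0, 1]
    simp [cubicPolar] at h0 h1 h2
    exact ⟨by linear_combination h0, by linear_combination h1, by linear_combination h2⟩

theorem cubicPolar_cubicOfPolar {R : Type*} [CommRing R] (g : Fin 10 → R) (c : Fin 3 → Fin 3 → R)
    (l P u v w : Fin 3 → R) :
    cubicPolar (cubicOfPolar fun i j k => cubicPolar g (c i) (c j) (c k)
        + l i * cubicPolar g (c j) (c k) P + l j * cubicPolar g (c i) (c k) P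
        + l k * cubicPolar g (c i) (c j) P) u v w =
      cubicPolar g (∑ i, u i • c i) (∑ i, v i • c i) (∑ i, w i • c i)
        + (∑ i, u i * l i) * cubicPolar g (∑ i, v i • c i) (∑ i, w i • c i) P
        + (∑ i, v i * l i) * cubicPolar g (∑ i, u i • c i) (∑ i, w i • c i) P
        + (∑ i, w i * l i) * cubicPolar g (∑ i, u i • c i) (∑ i, v i • c i) P := by
  simp only [cubicPolar, cubicOfPolar, Fin.sum_univ_three, Pi.add_apply, Pi.smul_apply, smul_eq_mul,
    Matrix.cons_val]
  ring

theorem sum_smul_killMap {R : Type*} [CommRing R] {n : ℕ} (P l : Fin n → R) :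
    ∑ i, P i • killMap P l i = 0 := by
  ext j
  simp only [killMap, Finset.sum_apply, Pi.smul_apply, smul_eq_mul, mul_sub, Finset.sum_sub_distrib,
    Pi.zero_apply]
  simp only [mul_ite, mul_one, mul_zero, Finset.sum_ite_eq, Finset.mem_univ, if_true]
  rw [sub_eq_zero, Finset.mul_sum]
  exact Finset.sum_congr rfl fun i _ => by ring

theorem isCubicNode_nodalCubic {R : Type*} [CommRing R] (P l : Fin 3 → R) (g : Fin 10 → R) :
    IsCubicNode (nodalCubic P l g) (P 0) (P 1) (P 2) := by
  rw [isCubicNode_iff_cubicPolar]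
  intro w
  rw [nodalCubic, cubicPolar_cubicOfPolar, sum_smul_killMap]
  simp [cubicPolar]

theorem nodalCubic_eq_self {R : Type*} [CommRing R] (P l : Fin 3 → R) (g : Fin 10 → R)
    (hl : ∑ i, l i * P i = 1) (h : ∀ w, cubicPolar g P P w = 0) : nodalCubic P l g = g := by
  have key (u v w : Fin 3 → R) (p q r : R) :
      cubicPolar g (u - p • P) (v - q • P) (w - r • P) + p * cubicPolar g (v - q • P) (w - r • P) P
        + q * cubicPolar g (u - p • P) (w - r • P) P + r * cubicPolar g (u - p • P) (v - q • P) P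
        = cubicPolar g u v w := by
    have hu := h u
    have hv := h v
    have hw := h w
    have hP := h P
    simp only [cubicPolar, Pi.sub_apply, Pi.smul_apply, smul_eq_mul] at hu hv hw hP ⊢
    linear_combination 2 * p * q * r * hP - q * r * hu - p * r * hv - p * q * hw
  have hkill (i : Fin 3) : killMap P l i = Pi.single i 1 - l i • P := by
    ext j
    simp [killMap, hl, Pi.single_apply]
  simp only [nodalCubic, hkill, key]
  ext i
  fin_cases i <;> simp [cubicOfPolar, cubicPolar]

theorem exists_classicalCubic_eq {F : Type*} [Field F] (h3 : (3 : F) ≠ 0) (h6 : (6 : F) ≠ 0)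
    (φ : Fin 10 → F) : ∃ t, classicalCubic t = φ := by
  refine ⟨![φ 0, φ 1, φ 2, φ 3 / 3, φ 4 / 3, φ 5 / 3, φ 6 / 3, φ 7 / 3, φ 8 / 3, φ 9 / 6], ?_⟩
  ext i
  fin_cases i <;> simp [classicalCubic, mul_div_cancel₀, h3, h6]

theorem exists_isSingularZero_cubicForm_iff_exists_singularModel₃ {F : Type*} [Field F]
    (h3 : (3 : F) ≠ 0) (h6 : (6 : F) ≠ 0) (φ : Fin 10 → F) :
    (∃ P : Fin 3 → F, P ≠ 0 ∧ IsSingularZero (cubicForm φ) P) ↔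
      ∃ t : Fin 3 ⊕ Fin 3 ⊕ Fin 10 → F, ∀ i, singularModel₃ t i = φ i := by
  constructor
  · rintro ⟨P, hP, h⟩
    obtain ⟨g, rfl⟩ := exists_classicalCubic_eq h3 h6 φ
    rw [isSingularZero_cubicForm_iff h3, isCubicNode_iff_cubicPolar] at h
    obtain ⟨k, hk⟩ := Function.ne_iff.mp hP
    refine ⟨Sum.elim P (Sum.elim (Pi.single k (P k)⁻¹) g), fun i => ?_⟩
    have hl : ∑ i, (Pi.single k (P k)⁻¹ : Fin 3 → F) i * P i = 1 := by
      simp only [Pi.single_apply, ite_mul, zero_mul, Finset.sum_ite_eq', Finset.mem_univ, if_true]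
      exact inv_mul_cancel₀ hk
    have := nodalCubic_eq_self P _ g hl h
    exact congrFun (congrArg classicalCubic this) i
  · rintro ⟨t, ht⟩
    obtain rfl : singularModel₃ t = φ := _root_.funext ht
    by_cases hP : t ∘ Sum.inl = 0
    · -- For `P = 0` the cubic is zero, and every point is singular.
      refine ⟨![1, 0, 0], by simp, (isSingularZero_cubicForm_iff h3 _ _).mpr ?_⟩
      have h0 : nodalCubic (t ∘ Sum.inl) (t ∘ Sum.inr ∘ Sum.inl) (t ∘ Sum.inr ∘ Sum.inr) = 0 := by
        have hk (l : Fin 3 → F) (i : Fin 3) : killMap 0 l i = 0 := by ext; simp [killMap]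
        have hp (g : Fin 10 → F) : cubicPolar g 0 0 0 = 0 := by simp [cubicPolar]
        simp only [hP, nodalCubic, hk, hp, mul_zero, add_zero]
        ext i
        fin_cases i <;> rfl
      rw [h0]
      simp [IsCubicNode]
    · exact ⟨_, hP, (isSingularZero_cubicForm_iff h3 _ _).mpr (isCubicNode_nodalCubic _ _ _)⟩

end CubicParam

theorem isDiscriminant_three {K : Type*} [Field K] (h2 : (2 : K) ≠ 0) (h3 : (3 : K) ≠ 0)
    (h2' : (2 : AlgebraicClosure K) ≠ 0) (h3' : (3 : AlgebraicClosure K) ≠ 0) :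
    IsDiscriminant K 3 (pullback K 3 (weierstrassDisc K)) := by
  have h6 : (6 : K) ≠ 0 := by
    rw [show (6 : K) = 2 * 3 by norm_num]
    positivity
  have h6' : (6 : AlgebraicClosure K) ≠ 0 := by
    rw [show (6 : AlgebraicClosure K) = 2 * 3 by norm_num]
    positivity
  have hconst : (34012224 : AlgebraicClosure K) ≠ 0 := by
    rw [show (34012224 : AlgebraicClosure K) = 2 ^ 6 * 3 ^ 12 by norm_num]
    positivity
  have hsing (φ : Fin 10 → AlgebraicClosure K) :
      (∃ P : Fin 3 → AlgebraicClosure K, P ≠ 0 ∧ IsSingularZero (cubicForm φ) P) ↔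
      weierstrassMap₃ K φ 0 ^ 3 - 27 * weierstrassMap₃ K φ 1 ^ 2 = 0 := by
    obtain ⟨t, rfl⟩ := exists_classicalCubic_eq h3' h6' φ
    exact exists_isSingularZero_cubicForm_iff h3 h6 h2' h3' t
  refine isDiscriminant_pullback h2 3 hsing (fun i => singularModel₃ X i) (fun φ => ?_)
    (classicalCubic ![-3, 0, 3 * Polynomial.X, 0, -1, 0, 1, Polynomial.X, 0, 0])
    (weierstrassMap₃ K _) rfl 1 one_ne_zero (34012224 * (1 - Polynomial.X) ^ 2)
    (by simpa using hconst) (by rw [map_one, one_mul, weierstrassMap₃_line h3 h6])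
  refine (exists_isSingularZero_cubicForm_iff_exists_singularModel₃ h3' h6' φ).trans
    (exists_congr fun t => ?_)
  exact forall_congr' fun i => by rw [← eval_singularModel₃]

end GenusOne

/-! ### Determinants of pencils of matrices -/

section Pencil

namespace Matrix

variable {n R S : Type*} [Fintype n] [DecidableEq n] [CommRing R] [CommRing S]

/-- The matrix with the rows of `A` in the positions `s` and those of `B` elsewhere. -/
def mixRows (A B : Matrix n n R) (s : Finset n) : Matrix n n R :=
  of fun i => if i ∈ s then A i else B i

theorem det_mixRows_map (f : R →+* S) (A B : Matrix n n R) (s : Finset n) :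
    (mixRows (A.map f) (B.map f) s).det = f (mixRows A B s).det := by
  rw [RingHom.map_det]
  congr 1
  ext i j
  by_cases hi : i ∈ s <;> simp [mixRows, hi]

/-- The determinant of `xA + zB` expanded in powers of `x` and `z`, by multilinearity in the
rows. -/
theorem det_smul_add_smul (A B : Matrix n n R) (x z : R) :
    (x • A + z • B).det =
      ∑ s : Finset n, x ^ s.card * z ^ (Fintype.card n - s.card) * (mixRows A B s).det := by
  have h := (detRowAlternating (n := n) (R := R)).toMultilinearMap.map_add_univ
    (fun i => x • A i) (fun i => z • B i)
  refine h.trans (Finset.sum_congr rfl fun s _ => ?_)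
  have hs : (s.piecewise (fun i => x • A i) (fun i => z • B i) : n → n → R) =
      of fun i j => (if i ∈ s then x else z) * mixRows A B s i j := by
    ext i j
    by_cases hi : i ∈ s <;> simp [hi, mixRows]
  refine (congrArg det hs).trans ?_
  rw [det_mul_column]
  congr 1
  rw [Finset.prod_ite, Finset.prod_const, Finset.prod_const, ← Finset.card_compl]
  congr 3
  · ext
    simp
  · ext
    simp

/-- The coefficients of the polynomial `det(XA + B)`. -/
theorem coeff_det_X_smul_add (A B : Matrix n n R) (k : ℕ) :
    (((Polynomial.X : Polynomial R) • A.map Polynomial.C + B.map Polynomial.C).det).coeff k =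
      ∑ s : Finset n, if s.card = k then (mixRows A B s).det else 0 := by
  rw [← one_smul (Polynomial R) (B.map Polynomial.C), det_smul_add_smul,
    Polynomial.finsetSum_coeff]
  refine Finset.sum_congr rfl fun s _ => ?_
  rw [det_mixRows_map, one_pow, mul_one, mul_comm, Polynomial.coeff_C_mul, Polynomial.coeff_X_pow]
  simp [eq_comm]

/-- The polynomial `det(XA + B)` determines the binary form `det(xA + zB)`, also after a base
change. -/
theorem det_smul_map_add_smul_map (f : R →+* S) (A B : Matrix n n R) (x z : S) :
    (x • A.map f + z • B.map f).det =
      ∑ k ∈ Finset.range (Fintype.card n + 1),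
        f ((((Polynomial.X : Polynomial R) • A.map Polynomial.C + B.map Polynomial.C).det).coeff k)
          * x ^ k * z ^ (Fintype.card n - k) := by
  rw [det_smul_add_smul]
  simp only [coeff_det_X_smul_add, map_sum, Finset.sum_mul, det_mixRows_map]
  rw [Finset.sum_comm]
  refine Finset.sum_congr rfl fun s _ => ?_
  rw [Finset.sum_eq_single s.card]
  · simp
    ring
  · intro k _ hk
    simp [hk.symm]
  · intro h
    exact absurd (Finset.mem_range.mpr (Nat.lt_succ_of_le s.card_le_univ)) h

/-- The derivative of the determinant at `M` is `N ↦ tr(adj(M) N)`. -/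
theorem coeff_one_det_X_smul_add (M N : Matrix n n R) :
    (((Polynomial.X : Polynomial R) • N.map Polynomial.C + M.map Polynomial.C).det).coeff 1 =
      ∑ j, ∑ i, M.adjugate i j * N j i := by
  rw [coeff_det_X_smul_add, ← Finset.sum_filter, ← Finset.powerset_univ,
    ← Finset.powersetCard_eq_filter, Finset.powersetCard_one, Finset.sum_map]
  refine Finset.sum_congr rfl fun j _ => ?_
  have h1 : mixRows N M {j} = M.updateRow j (N j) := by
    ext i k
    by_cases hi : i = j
    · subst hi
      simp [mixRows]
    · simp [mixRows, hi]
  have h2 : (M.updateRow j (N j)).det = (Mᵀ.adjugate.mulVec (N j)) j := by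
    rw [← cramer_eq_adjugate_mulVec, cramer_transpose_apply]
  refine (congrArg det h1).trans (h2.trans ?_)
  simp only [mulVec, dotProduct, ← adjugate_transpose, transpose_apply]

/-- If `M P = 0`, the columns of the adjugate of `M` are proportional to `P`. -/
theorem adjugate_mul_eq_of_mulVec_eq_zero {M : Matrix n n R} {P : n → R} (h : M.mulVec P = 0)
    (i j k : n) :
    P k * M.adjugate i j = P i * M.adjugate k j := by
  -- Apply the adjugate of `M`, with row `j` replaced by a unit vector, to the image of `P`.
  have h1 : (M.updateRow j (Pi.single i 1)).mulVec P = Pi.single j (P i) := by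
    ext l
    by_cases hl : l = j
    · subst hl
      simp [mulVec]
    · simpa [mulVec, updateRow_ne hl, hl] using congrFun h l
  have h2 := congrArg (fun v => (M.updateRow j (Pi.single i 1)).adjugate.mulVec v k) h1
  simp only [mulVec_mulVec, adjugate_mul, smul_mulVec, one_mulVec,
    Pi.smul_apply, smul_eq_mul, mulVec_single, MulOpposite.smul_eq_mul_unop,
    MulOpposite.unop_op] at h2
  rw [adjugate_apply, mul_comm, h2, col_apply, adjugate_apply,
    adjugate_apply, updateRow_idem]
  exact mul_comm _ _

/-- For a symmetric matrix `M` with `M P = 0`, the adjugate of `M` is proportional to `P Pᵀ`, so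
the linear coefficient of `det(M + XN)`, which is the trace of `adj(M) N`, is proportional to
`Pᵀ N P`. -/
theorem sq_mul_coeff_one_det {M N : Matrix n n R} {P : n → R} (hM : M.IsSymm)
    (h : M.mulVec P = 0) (k : n) :
    P k ^ 2 *
        (((Polynomial.X : Polynomial R) • N.map Polynomial.C + M.map Polynomial.C).det).coeff 1 =
      (P ⬝ᵥ N.mulVec P) * M.adjugate k k := by
  have hadj (i j : n) : P k ^ 2 * M.adjugate i j = P i * P j * M.adjugate k k := by
    have h1 := M.adjugate_mul_eq_of_mulVec_eq_zero h i j k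
    have h2 := M.adjugate_mul_eq_of_mulVec_eq_zero h j k k
    have h3 : M.adjugate k j = M.adjugate j k := by
      have := congrFun (congrFun M.adjugate_transpose j) k
      rwa [hM.eq] at this
    linear_combination P k * h1 + P i * P k * h3 + P i * h2
  rw [coeff_one_det_X_smul_add]
  simp only [Finset.mul_sum, ← mul_assoc, hadj, dotProduct, mulVec, Finset.sum_mul]
  refine Finset.sum_congr rfl fun j _ => Finset.sum_congr rfl fun i _ => ?_
  ring

end Matrix

end Pencil

namespace GenusOne

/-! ### Singular points of pencils of quadrics -/

section PencilNode

open Matrix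

variable {F : Type*} [Field F]

/-- A singular point `P` of the intersection of the quadrics with matrices `A` and `B`: it lies on
both, and their gradients there are linearly dependent. -/
def IsPencilNode (A B : Matrix (Fin 4) (Fin 4) F) (P : Fin 4 → F) : Prop :=
  P ≠ 0 ∧ P ⬝ᵥ A *ᵥ P = 0 ∧ P ⬝ᵥ B *ᵥ P = 0 ∧
    ∃ x z : F, (x ≠ 0 ∨ z ≠ 0) ∧ x • (A *ᵥ P) + z • (B *ᵥ P) = 0

/-- The polynomial `det(XA + B)`. -/
noncomputable def detPencil {R : Type*} [CommRing R] (A B : Matrix (Fin 4) (Fin 4) R) :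
    Polynomial R :=
  ((Polynomial.X : Polynomial R) • A.map Polynomial.C + B.map Polynomial.C).det

theorem det_smul_add_smul_eq (A B : Matrix (Fin 4) (Fin 4) F) (x z : F) :
    (x • A + z • B).det = (detPencil A B).coeff 4 * x ^ 4 + (detPencil A B).coeff 3 * x ^ 3 * z
      + (detPencil A B).coeff 2 * x ^ 2 * z ^ 2 + (detPencil A B).coeff 1 * x * z ^ 3
      + (detPencil A B).coeff 0 * z ^ 4 := by
  have h := det_smul_map_add_smul_map (RingHom.id F) A B x z
  simp only [RingHom.coe_id, Matrix.map_id, id_eq, Fintype.card_fin] at h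
  rw [h, ← detPencil]
  simp [Finset.sum_range_succ]
  ring

/-- The derivative of the binary quartic `det(xA + zB)` at `(x, z)` in the direction `(x', z')`. -/
theorem coeff_one_detPencil (A B : Matrix (Fin 4) (Fin 4) F) (x z x' z' : F) :
    (detPencil (x' • A + z' • B) (x • A + z • B)).coeff 1 =
      x' * (4 * (detPencil A B).coeff 4 * x ^ 3 + 3 * (detPencil A B).coeff 3 * x ^ 2 * z
        + 2 * (detPencil A B).coeff 2 * x * z ^ 2 + (detPencil A B).coeff 1 * z ^ 3)
      + z' * ((detPencil A B).coeff 3 * x ^ 3 + 2 * (detPencil A B).coeff 2 * x ^ 2 * z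
        + 3 * (detPencil A B).coeff 1 * x * z ^ 2 + 4 * (detPencil A B).coeff 0 * z ^ 3) := by
  have h1 : detPencil (x' • A + z' • B) (x • A + z • B) =
      ((Polynomial.C x + Polynomial.C x' * Polynomial.X) • A.map Polynomial.C
        + (Polynomial.C z + Polynomial.C z' * Polynomial.X) • B.map Polynomial.C).det := by
    rw [detPencil]
    congr 1
    ext1 i j
    simp
    ring
  have h2 (p : Polynomial F) : p.coeff 1 = (Polynomial.derivative p).eval 0 := by
    rw [← Polynomial.coeff_zero_eq_eval_zero, Polynomial.coeff_derivative]
    simp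
  rw [h1, det_smul_map_add_smul_map, h2, ← detPencil]
  simp [Finset.sum_range_succ, Polynomial.derivative_pow]
  ring

theorem quarticDisc_detPencil_eq_zero_of_isPencilNode [IsAlgClosed F] (h2 : (2 : F) ≠ 0)
    (h3 : (3 : F) ≠ 0) {A B : Matrix (Fin 4) (Fin 4) F} (hA : A.IsSymm) (hB : B.IsSymm)
    {P : Fin 4 → F} (h : IsPencilNode A B P) :
    quarticDisc ((detPencil A B).coeff 4) ((detPencil A B).coeff 3) ((detPencil A B).coeff 2)
      ((detPencil A B).coeff 1) ((detPencil A B).coeff 0) = 0 := by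
  obtain ⟨hP, hPA, hPB, x, z, hxz, h⟩ := h
  obtain ⟨k, hk⟩ := Function.ne_iff.mp hP
  have key (x' z' : F) : (detPencil (x' • A + z' • B) (x • A + z • B)).coeff 1 = 0 := by
    have h1 := sq_mul_coeff_one_det (M := x • A + z • B) (N := x' • A + z' • B) (P := P)
      ((hA.smul x).add (hB.smul z)) (by rw [add_mulVec, smul_mulVec, smul_mulVec, h]) k
    rw [add_mulVec, smul_mulVec, smul_mulVec, dotProduct_add, dotProduct_smul, dotProduct_smul,
      hPA, hPB, smul_zero, smul_zero, add_zero, zero_mul] at h1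
    exact (mul_eq_zero.mp h1).resolve_left (pow_ne_zero 2 hk)
  simp only [coeff_one_detPencil] at key
  refine (quarticDisc_eq_zero_iff h2 h3 _ _ _ _ _).mpr ⟨x, z, hxz, ?_, ?_⟩
  · linear_combination key 1 0
  · linear_combination key 0 1

/-- At a double zero of `det(xA + zB)` there is a singular point. Let `M` be the degenerate member
of the pencil and `N` another one, and let `P` be in the kernel of `M`. If the quadric of `N` does
not pass through `P`, then the kernel of `M` has dimension at least two, and the quadric of `N`
meets it. -/
theorem exists_isPencilNode_of_quarticDisc_eq_zero [IsAlgClosed F] (h2 : (2 : F) ≠ 0)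
    (h3 : (3 : F) ≠ 0) {A B : Matrix (Fin 4) (Fin 4) F} (hA : A.IsSymm) (hB : B.IsSymm)
    (h : quarticDisc ((detPencil A B).coeff 4) ((detPencil A B).coeff 3)
      ((detPencil A B).coeff 2) ((detPencil A B).coeff 1) ((detPencil A B).coeff 0) = 0) :
    ∃ P, IsPencilNode A B P := by
  obtain ⟨x, z, hxz, hx, hz⟩ := (quarticDisc_eq_zero_iff h2 h3 _ _ _ _ _).mp h
  obtain ⟨x', z', hdet⟩ : ∃ x' z' : F, x * z' - x' * z = 1 := by
    rcases hxz with hx | hz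
    · exact ⟨0, x⁻¹, by simp [hx]⟩
    · exact ⟨-z⁻¹, 0, by simp [hz]⟩
  obtain ⟨M, hM⟩ : ∃ M, M = x • A + z • B := ⟨_, rfl⟩
  obtain ⟨N, hN⟩ : ∃ N, N = x' • A + z' • B := ⟨_, rfl⟩
  have hMsymm : M.IsSymm := hM ▸ (hA.smul x).add (hB.smul z)
  have hdet0 : M.det = 0 := by
    apply mul_left_cancel₀ (mul_ne_zero h2 h2)
    rw [hM, det_smul_add_smul_eq]
    linear_combination x * hx + z * hz
  have hcoeff : (detPencil N M).coeff 1 = 0 := by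
    rw [hM, hN, coeff_one_detPencil, hx, hz]
    ring
  -- It suffices to find a point of the quadric of `N` in the kernel of `M`.
  suffices ∃ v, v ≠ 0 ∧ M *ᵥ v = 0 ∧ v ⬝ᵥ N *ᵥ v = 0 by
    obtain ⟨v, hv, hMv, hNv⟩ := this
    have hA' : A = z' • M - z • N := by
      ext i j
      simp only [hM, hN, Matrix.sub_apply, Matrix.smul_apply, Matrix.add_apply, smul_eq_mul]
      linear_combination -A i j * hdet
    have hB' : B = x • N - x' • M := by
      ext i j
      simp only [hM, hN, Matrix.sub_apply, Matrix.smul_apply, Matrix.add_apply, smul_eq_mul]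
      linear_combination -B i j * hdet
    refine ⟨v, hv, ?_, ?_, x, z, hxz, ?_⟩
    · rw [hA', sub_mulVec, smul_mulVec, smul_mulVec, dotProduct_sub, dotProduct_smul,
        dotProduct_smul, hMv, hNv]
      simp
    · rw [hB', sub_mulVec, smul_mulVec, smul_mulVec, dotProduct_sub, dotProduct_smul,
        dotProduct_smul, hMv, hNv]
      simp
    · rw [← smul_mulVec, ← smul_mulVec, ← add_mulVec, ← hM, hMv]
  obtain ⟨P, hP, hMP⟩ := exists_mulVec_eq_zero_iff.mpr hdet0
  obtain ⟨k, hk⟩ := Function.ne_iff.mp hP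
  have h1 := sq_mul_coeff_one_det (N := N) hMsymm hMP k
  rw [← detPencil, hcoeff, mul_zero, eq_comm] at h1
  rcases mul_eq_zero.mp h1 with h1 | h1
  · exact ⟨P, hP, hMP, h1⟩
  · -- The minor of `M` at `k` vanishes, which gives a second vector `w` in the kernel of `M`.
    rw [adjugate_apply] at h1
    obtain ⟨w, hw, hMw⟩ := exists_mulVec_eq_zero_iff.mpr h1
    have hwk : w k = 0 := by simpa [mulVec] using congrFun hMw k
    have hMw' (i : Fin 4) (hi : i ≠ k) : (M *ᵥ w) i = 0 := by
      simpa [mulVec, updateRow_ne hi] using congrFun hMw i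
    have hMwk : (M *ᵥ w) k = 0 := by
      have h4 : P ⬝ᵥ M *ᵥ w = 0 := by
        rw [dotProduct_mulVec, ← mulVec_transpose, hMsymm.eq, hMP, zero_dotProduct]
      rw [dotProduct, Finset.sum_eq_single k (fun i _ hi => by rw [hMw' i hi, mul_zero])
        (fun h => absurd (Finset.mem_univ k) h)] at h4
      exact (mul_eq_zero.mp h4).resolve_left hk
    have hMw0 : M *ᵥ w = 0 := by
      ext i
      by_cases hi : i = k
      · rw [hi, hMwk, Pi.zero_apply]
      · exact hMw' i hi
    obtain ⟨r, s, hrs, h0⟩ := exists_quadratic_zero (P ⬝ᵥ N *ᵥ P)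
      (P ⬝ᵥ N *ᵥ w + w ⬝ᵥ N *ᵥ P) (w ⬝ᵥ N *ᵥ w)
    refine ⟨r • P + s • w, fun h => ?_, ?_, ?_⟩
    · have hr : r = 0 := by simpa [hwk, show P k ≠ 0 from hk] using congrFun h k
      have hs : s ≠ 0 := by tauto
      rw [hr, zero_smul, zero_add] at h
      exact hw ((smul_eq_zero.mp h).resolve_left hs)
    · rw [mulVec_add, mulVec_smul, mulVec_smul, hMP, hMw0, smul_zero, smul_zero, add_zero]
    · simp only [mulVec_add, mulVec_smul, add_dotProduct, dotProduct_add, smul_dotProduct,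
        dotProduct_smul, smul_eq_mul]
      linear_combination h0

end PencilNode
/-! ### Models of degree 4 -/

section DegreeFour

open Matrix

/-- The quadric `∑ sᵢⱼ xᵢ xⱼ` as a coefficient vector for `quadricForm`, from the entries of its
symmetric matrix at the positions `00, 11, 22, 33, 01, 02, 03, 12, 13, 23`. -/
def classicalQuadric {R : Type*} [CommRing R] (s : Fin 10 → R) : Fin 10 → R :=
  ![s 0, s 1, s 2, s 3, 2 * s 4, 2 * s 5, 2 * s 6, 2 * s 7, 2 * s 8, 2 * s 9]

/-- The symmetric matrix with the given entries at the positions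
`00, 11, 22, 33, 01, 02, 03, 12, 13, 23`. -/
def symMatrix {R : Type*} (s : Fin 10 → R) : Matrix (Fin 4) (Fin 4) R :=
  !![s 0, s 4, s 5, s 6; s 4, s 1, s 7, s 8; s 5, s 7, s 2, s 9; s 6, s 8, s 9, s 3]

/-- The entries of a matrix at the positions `00, 11, 22, 33, 01, 02, 03, 12, 13, 23`. -/
def upperEntries {R : Type*} (A : Matrix (Fin 4) (Fin 4) R) : Fin 10 → R :=
  ![A 0 0, A 1 1, A 2 2, A 3 3, A 0 1, A 0 2, A 0 3, A 1 2, A 1 3, A 2 3]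

/-- The pair of quadrics with the given symmetric matrices. -/
def matrixPair {R : Type*} [CommRing R] (A B : Matrix (Fin 4) (Fin 4) R) : Fin 20 → R :=
  Fin.append (classicalQuadric (upperEntries A)) (classicalQuadric (upperEntries B))

theorem symMatrix_upperEntries {R : Type*} {A : Matrix (Fin 4) (Fin 4) R} (hA : A.IsSymm) :
    symMatrix (upperEntries A) = A := by
  ext i j
  fin_cases i <;> fin_cases j <;> simp [symMatrix, upperEntries] <;> exact hA.apply _ _

theorem quadricPair_matrixPair_zero {R : Type*} [CommRing R] (A B : Matrix (Fin 4) (Fin 4) R) :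
    quadricPair (matrixPair A B) 0 = classicalQuadric (upperEntries A) :=
  _root_.funext fun i => Fin.append_left _ _ i

theorem quadricPair_matrixPair_one {R : Type*} [CommRing R] (A B : Matrix (Fin 4) (Fin 4) R) :
    quadricPair (matrixPair A B) 1 = classicalQuadric (upperEntries B) :=
  _root_.funext fun i => Fin.append_right _ _ i

theorem exists_matrixPair_eq {F : Type*} [Field F] (h2 : (2 : F) ≠ 0) (φ : Fin 20 → F) :
    ∃ A B : Matrix (Fin 4) (Fin 4) F, A.IsSymm ∧ B.IsSymm ∧ matrixPair A B = φ := by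
  have key (q : Fin 10 → F) : ∃ A : Matrix (Fin 4) (Fin 4) F, A.IsSymm ∧
      classicalQuadric (upperEntries A) = q := by
    refine ⟨symMatrix ![q 0, q 1, q 2, q 3, q 4 / 2, q 5 / 2, q 6 / 2, q 7 / 2, q 8 / 2, q 9 / 2],
      ?_, ?_⟩
    · ext i j
      fin_cases i <;> fin_cases j <;> rfl
    · ext i
      fin_cases i <;> simp [classicalQuadric, upperEntries, symMatrix, mul_div_cancel₀, h2]
  obtain ⟨A, hA, hA'⟩ := key (fun i => φ (Fin.castAdd 10 i))
  obtain ⟨B, hB, hB'⟩ := key (fun i => φ (Fin.natAdd 10 i))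
  refine ⟨A, B, hA, hB, ?_⟩
  rw [matrixPair, hA', hB']
  exact Fin.append_castAdd_natAdd

theorem eq_and_eq_of_matrixPair_eq {F : Type*} [Field F] (h2 : (2 : F) ≠ 0)
    {A B A' B' : Matrix (Fin 4) (Fin 4) F} (hA : A.IsSymm) (hB : B.IsSymm) (hA' : A'.IsSymm)
    (hB' : B'.IsSymm) (h : matrixPair A B = matrixPair A' B') : A = A' ∧ B = B' := by
  have key {s s' : Fin 10 → F} (h : classicalQuadric s = classicalQuadric s') : s = s' := by
    ext i
    have := congrFun h i
    fin_cases i <;> simpa [classicalQuadric, h2] using this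
  rw [← symMatrix_upperEntries hA, ← symMatrix_upperEntries hB, ← symMatrix_upperEntries hA',
    ← symMatrix_upperEntries hB']
  constructor <;> refine congrArg symMatrix (key ?_)
  · rw [← quadricPair_matrixPair_zero A B, h, quadricPair_matrixPair_zero]
  · rw [← quadricPair_matrixPair_one A B, h, quadricPair_matrixPair_one]

theorem pencilDet_matrixPair {K A : Type*} [Field K] [CommRing A] [Algebra K A] (h2 : (2 : K) ≠ 0)
    {M N : Matrix (Fin 4) (Fin 4) A} (hM : M.IsSymm) (hN : N.IsSymm) :
    pencilDet K (matrixPair M N) = detPencil M N := by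
  have key {M : Matrix (Fin 4) (Fin 4) A} (hM : M.IsSymm) :
      quadricMatrix K (classicalQuadric (upperEntries M)) = M := by
    rw [← symMatrix_upperEntries hM]
    ext i j
    fin_cases i <;> fin_cases j <;>
      simp [quadricMatrix, classicalQuadric, symMatrix, upperEntries, inv_smul_ofNat_mul h2]
  rw [pencilDet, quadricPair_matrixPair_zero, quadricPair_matrixPair_one, key hM, key hN, detPencil]

variable {F : Type*} [Field F]

theorem dotProduct_symMatrix_mulVec (s : Fin 10 → F) (P : Fin 4 → F) :
    P ⬝ᵥ symMatrix s *ᵥ P = s 0 * P 0 ^ 2 + s 1 * P 1 ^ 2 + s 2 * P 2 ^ 2 + s 3 * P 3 ^ 2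
      + 2 * s 4 * P 0 * P 1 + 2 * s 5 * P 0 * P 2 + 2 * s 6 * P 0 * P 3 + 2 * s 7 * P 1 * P 2
      + 2 * s 8 * P 1 * P 3 + 2 * s 9 * P 2 * P 3 := by
  simp only [symMatrix, dotProduct, mulVec, Fin.sum_univ_four, of_apply, cons_val]
  ring

theorem eval_quadricForm (q : Fin 10 → F) (P : Fin 4 → F) :
    eval P (quadricForm q) = q 0 * P 0 ^ 2 + q 1 * P 1 ^ 2 + q 2 * P 2 ^ 2 + q 3 * P 3 ^ 2
      + q 4 * P 0 * P 1 + q 5 * P 0 * P 2 + q 6 * P 0 * P 3 + q 7 * P 1 * P 2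
      + q 8 * P 1 * P 3 + q 9 * P 2 * P 3 := by
  simp [quadricForm]

theorem eval_quadricForm_classicalQuadric (s : Fin 10 → F) (P : Fin 4 → F) :
    eval P (quadricForm (classicalQuadric s)) = P ⬝ᵥ symMatrix s *ᵥ P := by
  rw [eval_quadricForm, dotProduct_symMatrix_mulVec]
  simp only [classicalQuadric, cons_val]

theorem eval_pderiv_quadricForm (q : Fin 10 → F) (P : Fin 4 → F) (i : Fin 4) :
    eval P (pderiv i (quadricForm q)) =
      ![2 * q 0 * P 0 + q 4 * P 1 + q 5 * P 2 + q 6 * P 3,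
        q 4 * P 0 + 2 * q 1 * P 1 + q 7 * P 2 + q 8 * P 3,
        q 5 * P 0 + q 7 * P 1 + 2 * q 2 * P 2 + q 9 * P 3,
        q 6 * P 0 + q 8 * P 1 + q 9 * P 2 + 2 * q 3 * P 3] i := by
  fin_cases i
  all_goals
    simp [quadricForm, pderiv_X]
    ring

theorem eval_pderiv_quadricForm_classicalQuadric (s : Fin 10 → F) (P : Fin 4 → F) (i : Fin 4) :
    eval P (pderiv i (quadricForm (classicalQuadric s))) = 2 * (symMatrix s *ᵥ P) i := by
  rw [eval_pderiv_quadricForm]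
  fin_cases i
  all_goals
    simp only [classicalQuadric, symMatrix, mulVec, dotProduct, Fin.sum_univ_four, of_apply,
      cons_val, Fin.zero_eta, Fin.mk_one, Fin.reduceFinMk]
    ring

theorem isSingular_matrixPair_iff (h2 : (2 : F) ≠ 0) {A B : Matrix (Fin 4) (Fin 4) F}
    (hA : A.IsSymm) (hB : B.IsSymm) :
    (∃ P : Fin 4 → F, P ≠ 0 ∧
      (∀ k, eval P (quadricForm (quadricPair (matrixPair A B) k)) = 0) ∧
      ¬ LinearIndependent F (fun (k : Fin 2) (i : Fin 4) =>
        eval P (pderiv i (quadricForm (quadricPair (matrixPair A B) k))))) ↔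
      ∃ P, IsPencilNode A B P := by
  refine exists_congr fun P => and_congr_right fun hP => ?_
  rw [Fin.forall_fin_two, Fintype.not_linearIndependent_iff, quadricPair_matrixPair_zero,
    quadricPair_matrixPair_one, eval_quadricForm_classicalQuadric,
    eval_quadricForm_classicalQuadric, symMatrix_upperEntries hA, symMatrix_upperEntries hB,
    and_assoc]
  refine and_congr_right fun _ => and_congr_right fun _ => ?_
  have hsum (g : Fin 2 → F) : ∑ k, g k • (fun i : Fin 4 =>
      eval P (pderiv i (quadricForm (quadricPair (matrixPair A B) k)))) =
      (2 : F) • (g 0 • (A *ᵥ P) + g 1 • (B *ᵥ P)) := by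
    ext i
    rw [Fin.sum_univ_two, quadricPair_matrixPair_zero, quadricPair_matrixPair_one]
    simp only [eval_pderiv_quadricForm_classicalQuadric, symMatrix_upperEntries hA,
      symMatrix_upperEntries hB, Pi.add_apply, Pi.smul_apply, smul_eq_mul]
    ring
  simp only [hsum, smul_eq_zero_iff_right h2, Fin.exists_fin_two]
  constructor
  · rintro ⟨g, h, hg⟩
    exact ⟨g 0, g 1, hg, h⟩
  · rintro ⟨x, z, hxz, h⟩
    exact ⟨![x, z], h, hxz⟩

/-- The matrix of the quadratic form `m(Tx, Tx)`, where `Tx = ℓ(P)x - ℓ(x)P` and `m` is a symmetric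
bilinear form. It kills `P`. -/
def coneMatrix {R : Type*} [CommRing R] (P l : Fin 4 → R) (m : Fin 10 → R) :
    Matrix (Fin 4) (Fin 4) R :=
  of (killMap P l) * symMatrix m * (of (killMap P l))ᵀ

/-- The matrix of the quadratic form `g(Tx, Tx) + 2ℓ(x)g(Tx, P)`, where `Tx = ℓ(P)x - ℓ(x)P` and `g`
is a symmetric bilinear form. It vanishes at `P`. -/
def throughMatrix {R : Type*} [CommRing R] (P l : Fin 4 → R) (g : Fin 10 → R) :
    Matrix (Fin 4) (Fin 4) R :=
  of (killMap P l) * symMatrix g * (of (killMap P l))ᵀ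
    + (vecMulVec l (of (killMap P l) *ᵥ symMatrix g *ᵥ P)
      + vecMulVec (of (killMap P l) *ᵥ symMatrix g *ᵥ P) l)

theorem isSymm_symMatrix {R : Type*} (s : Fin 10 → R) : (symMatrix s).IsSymm := by
  ext i j
  fin_cases i <;> fin_cases j <;> rfl

theorem isSymm_coneMatrix {R : Type*} [CommRing R] (P l : Fin 4 → R) (m : Fin 10 → R) :
    (coneMatrix P l m).IsSymm := by
  rw [coneMatrix, IsSymm, transpose_mul, transpose_mul, transpose_transpose,
    (isSymm_symMatrix m).eq, Matrix.mul_assoc]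

theorem isSymm_throughMatrix {R : Type*} [CommRing R] (P l : Fin 4 → R) (g : Fin 10 → R) :
    (throughMatrix P l g).IsSymm := by
  refine IsSymm.add (isSymm_coneMatrix P l g) ?_
  rw [IsSymm, transpose_add, transpose_vecMulVec, transpose_vecMulVec, add_comm]

theorem transpose_killMap_mulVec {R : Type*} [CommRing R] (P l : Fin 4 → R) :
    (of (killMap P l))ᵀ *ᵥ P = 0 := by
  rw [← sum_smul_killMap P l]
  ext j
  simp [mulVec, dotProduct, mul_comm]

theorem coneMatrix_mulVec {R : Type*} [CommRing R] (P l : Fin 4 → R) (m : Fin 10 → R) :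
    coneMatrix P l m *ᵥ P = 0 := by
  rw [coneMatrix, ← mulVec_mulVec, transpose_killMap_mulVec, mulVec_zero]

theorem dotProduct_throughMatrix_mulVec {R : Type*} [CommRing R] (P l : Fin 4 → R)
    (g : Fin 10 → R) : P ⬝ᵥ throughMatrix P l g *ᵥ P = 0 := by
  have h (v : Fin 4 → R) : of (killMap P l) *ᵥ v ⬝ᵥ P = 0 := by
    rw [dotProduct_comm, dotProduct_mulVec, ← mulVec_transpose, transpose_killMap_mulVec,
      zero_dotProduct]
  rw [throughMatrix, add_mulVec, ← coneMatrix, coneMatrix_mulVec, zero_add, add_mulVec,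
    vecMulVec_mulVec, vecMulVec_mulVec, h, dotProduct_add]
  simp [-mulVec_mulVec, dotProduct_comm P, h]

/-- The pairs of quadrics that are spanned by a quadric with vertex `P` and a quadric through `P`,
for the parameters `P`, `ℓ`, two quadrics, and the four coefficients of the change of basis. -/
def singularModel₄ {R : Type*} [CommRing R]
    (t : Fin 4 ⊕ Fin 4 ⊕ Fin 10 ⊕ Fin 10 ⊕ Fin 4 → R) : Fin 20 → R :=
  let P : Fin 4 → R := fun i => t (.inl i)
  let l : Fin 4 → R := fun i => t (.inr (.inl i))
  let M := coneMatrix P l fun i => t (.inr (.inr (.inl i)))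
  let N := throughMatrix P l fun i => t (.inr (.inr (.inr (.inl i))))
  let c : Fin 4 → R := fun i => t (.inr (.inr (.inr (.inr i))))
  matrixPair (c 0 • M + c 1 • N) (c 2 • M + c 3 • N)

theorem map_matrixPair {R S : Type*} [CommRing R] [CommRing S] (f : R →+* S)
    (A B : Matrix (Fin 4) (Fin 4) R) (i : Fin 20) :
    f (matrixPair A B i) = matrixPair (A.map f) (B.map f) i := by
  have key (A : Matrix (Fin 4) (Fin 4) R) (i : Fin 10) :
      f (classicalQuadric (upperEntries A) i) = classicalQuadric (upperEntries (A.map f)) i := by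
    fin_cases i <;> simp [classicalQuadric, upperEntries, map_ofNat]
  refine Fin.addCases (m := 10) (n := 10) (fun j => ?_) (fun j => ?_) i
  · exact (congrArg f (Fin.append_left _ _ j)).trans
      ((key A j).trans (Fin.append_left _ _ j).symm)
  · exact (congrArg f (Fin.append_right _ _ j)).trans
      ((key B j).trans (Fin.append_right _ _ j).symm)

theorem map_symMatrix {R S : Type*} (f : R → S) (s : Fin 10 → R) :
    (symMatrix s).map f = symMatrix (f ∘ s) := by
  ext i j
  fin_cases i <;> fin_cases j <;> rfl

theorem map_killMap {R S : Type*} [CommRing R] [CommRing S] (f : R →+* S) (P l : Fin 4 → R) :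
    (of (killMap P l)).map f = of (killMap (f ∘ P) (f ∘ l)) := by
  ext i j
  exact congrFun (comp_killMap f P l i) j

theorem map_coneMatrix {R S : Type*} [CommRing R] [CommRing S] (f : R →+* S) (P l : Fin 4 → R)
    (m : Fin 10 → R) : (coneMatrix P l m).map f = coneMatrix (f ∘ P) (f ∘ l) (f ∘ m) := by
  rw [coneMatrix, Matrix.map_mul, Matrix.map_mul, map_symMatrix, coneMatrix, ← map_killMap]
  rfl

theorem map_throughMatrix {R S : Type*} [CommRing R] [CommRing S] (f : R →+* S)
    (P l : Fin 4 → R) (g : Fin 10 → R) :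
    (throughMatrix P l g).map f = throughMatrix (f ∘ P) (f ∘ l) (f ∘ g) := by
  have hv : f ∘ (of (killMap P l) *ᵥ symMatrix g *ᵥ P) =
      of (killMap (f ∘ P) (f ∘ l)) *ᵥ symMatrix (f ∘ g) *ᵥ (f ∘ P) := by
    ext i
    rw [Function.comp_apply, RingHom.map_mulVec, map_killMap, ← map_symMatrix]
    congr 2
    ext j
    exact RingHom.map_mulVec f _ _ j
  have hw (v w : Fin 4 → R) : (vecMulVec v w).map f = vecMulVec (f ∘ v) (f ∘ w) := by
    ext i j
    simp [vecMulVec_apply]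
  rw [throughMatrix, Matrix.map_add f (map_add f), Matrix.map_add f (map_add f), ← coneMatrix,
    map_coneMatrix, hw, hw, hv, throughMatrix, ← coneMatrix]

theorem eval_singularModel₄ {R : Type*} [CommRing R]
    (t : Fin 4 ⊕ Fin 4 ⊕ Fin 10 ⊕ Fin 10 ⊕ Fin 4 → R) (i : Fin 20) :
    eval t (singularModel₄ X i) = singularModel₄ t i := by
  have hsmul (a : MvPolynomial (Fin 4 ⊕ Fin 4 ⊕ Fin 10 ⊕ Fin 10 ⊕ Fin 4) R)
      (A : Matrix (Fin 4) (Fin 4) _) : (a • A).map (eval t) = eval t a • A.map (eval t) :=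
    Matrix.map_smul' _ _ _ (map_mul (eval t))
  simp only [singularModel₄]
  rw [map_matrixPair]
  simp only [Matrix.map_add _ (map_add (eval t)), hsmul, map_coneMatrix, map_throughMatrix,
    eval_X, Function.comp_def]

/-- A matrix `M` with `M P = 0` is `coneMatrix P l` of itself when `ℓ(P) = 1`. -/
theorem coneMatrix_eq_self {P l : Fin 4 → F} (hl : ∑ k, l k * P k = 1)
    {M : Matrix (Fin 4) (Fin 4) F} (hM : M.IsSymm) (h : M *ᵥ P = 0) :
    coneMatrix P l (upperEntries M) = M := by
  have hU : of (killMap P l) = 1 - vecMulVec l P := by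
    ext i j
    simp [killMap, hl, one_apply, vecMulVec_apply, eq_comm]
  have h' : P ᵥ* M = 0 := by rw [← mulVec_transpose, hM.eq, h]
  rw [coneMatrix, hU, symMatrix_upperEntries hM, transpose_sub, transpose_one, transpose_vecMulVec,
    Matrix.sub_mul, Matrix.one_mul, vecMulVec_mul, h', vecMulVec_zero, sub_zero, Matrix.mul_sub,
    Matrix.mul_one, mul_vecMulVec, h, zero_vecMulVec, sub_zero]

/-- The matrix of a quadric through `P` is `throughMatrix P l` of itself when `ℓ(P) = 1`. -/
theorem throughMatrix_eq_self {P l : Fin 4 → F} (hl : ∑ k, l k * P k = 1)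
    {N : Matrix (Fin 4) (Fin 4) F} (hN : N.IsSymm) (h : P ⬝ᵥ N *ᵥ P = 0) :
    throughMatrix P l (upperEntries N) = N := by
  have hU : of (killMap P l) = 1 - vecMulVec l P := by
    ext i j
    simp [killMap, hl, one_apply, vecMulVec_apply, eq_comm]
  have h' : P ᵥ* N = N *ᵥ P := by rw [← mulVec_transpose, hN.eq]
  have hv : (1 - vecMulVec l P) *ᵥ N *ᵥ P = N *ᵥ P := by
    rw [sub_mulVec, one_mulVec, vecMulVec_mulVec, h]
    simp
  rw [throughMatrix, hU, symMatrix_upperEntries hN, hv, transpose_sub, transpose_one,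
    transpose_vecMulVec, Matrix.mul_sub, Matrix.mul_one, mul_vecMulVec, ← mulVec_mulVec, hv,
    Matrix.sub_mul, Matrix.one_mul, vecMulVec_mul, h']
  abel

/-- The singular models of degree 4 are those of the form `singularModel₄`: a linear dependence
of the gradients at `P` gives a member of the pencil with vertex `P`. -/
theorem exists_isPencilNode_iff (h2 : (2 : F) ≠ 0) {A B : Matrix (Fin 4) (Fin 4) F}
    (hA : A.IsSymm) (hB : B.IsSymm) :
    (∃ P, IsPencilNode A B P) ↔ ∃ t, ∀ i, singularModel₄ t i = matrixPair A B i := by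
  constructor
  · rintro ⟨P, hP, hPA, hPB, x, z, hxz, h⟩
    obtain ⟨k, hk⟩ := Function.ne_iff.mp hP
    obtain ⟨l, hl⟩ : ∃ l : Fin 4 → F, ∑ k, l k * P k = 1 := by
      refine ⟨Pi.single k (P k)⁻¹, ?_⟩
      simp only [Pi.single_apply, ite_mul, zero_mul, Finset.sum_ite_eq', Finset.mem_univ, if_true]
      exact inv_mul_cancel₀ hk
    obtain ⟨x', z', hdet⟩ : ∃ x' z' : F, x * z' - x' * z = 1 := by
      rcases hxz with hx | hz
      · exact ⟨0, x⁻¹, by simp [hx]⟩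
      · exact ⟨-z⁻¹, 0, by simp [hz]⟩
    have hM := coneMatrix_eq_self hl ((hA.smul x).add (hB.smul z))
      (by rw [add_mulVec, smul_mulVec, smul_mulVec, h])
    have hN := throughMatrix_eq_self hl ((hA.smul x').add (hB.smul z'))
      (by rw [add_mulVec, smul_mulVec, smul_mulVec, dotProduct_add, dotProduct_smul,
        dotProduct_smul, hPA, hPB]; simp)
    refine ⟨Sum.elim P (Sum.elim l (Sum.elim (upperEntries (x • A + z • B))
      (Sum.elim (upperEntries (x' • A + z' • B)) ![z', -z, -x', x]))), fun i => ?_⟩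
    simp only [singularModel₄, Sum.elim_inl, Sum.elim_inr, cons_val]
    rw [hM, hN]
    congr 2 <;> ext i j <;>
      simp only [Matrix.smul_apply, Matrix.add_apply, smul_eq_mul]
    · linear_combination A i j * hdet
    · linear_combination B i j * hdet
  · rintro ⟨t, ht⟩
    set P : Fin 4 → F := fun i => t (.inl i)
    set l : Fin 4 → F := fun i => t (.inr (.inl i))
    set m : Fin 10 → F := fun i => t (.inr (.inr (.inl i)))
    set g : Fin 10 → F := fun i => t (.inr (.inr (.inr (.inl i))))
    set c : Fin 4 → F := fun i => t (.inr (.inr (.inr (.inr i))))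
    have hM := isSymm_coneMatrix P l m
    have hN := isSymm_throughMatrix P l g
    obtain ⟨rfl, rfl⟩ : A = c 0 • coneMatrix P l m + c 1 • throughMatrix P l g ∧
        B = c 2 • coneMatrix P l m + c 3 • throughMatrix P l g :=
      eq_and_eq_of_matrixPair_eq h2 hA hB ((hM.smul _).add (hN.smul _))
        ((hM.smul _).add (hN.smul _)) (_root_.funext fun i => (ht i).symm)
    clear_value P l m g c
    by_cases hP0 : P = 0
    · -- For `P = 0` both matrices are zero, and every point is a node.
      have hU : of (killMap (0 : Fin 4 → F) l) = 0 := by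
        ext i j
        simp [killMap]
      have hM0 : coneMatrix P l m = 0 := by
        rw [hP0, coneMatrix, hU, Matrix.zero_mul, Matrix.zero_mul]
      have hN0 : throughMatrix P l g = 0 := by
        rw [throughMatrix, hP0, hU]
        simp
      refine ⟨Pi.single 0 1, by simp, ?_, ?_, 1, 0, by simp, ?_⟩ <;>
        simp only [hM0, hN0, smul_zero, add_zero, zero_mulVec, dotProduct_zero]
    · have hmul (a b : F) : (a • coneMatrix P l m + b • throughMatrix P l g) *ᵥ P =
          b • throughMatrix P l g *ᵥ P := by
        rw [add_mulVec, smul_mulVec, smul_mulVec, coneMatrix_mulVec, smul_zero, zero_add]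
      refine ⟨P, hP0, ?_, ?_, ?_⟩
      · rw [hmul, dotProduct_smul, dotProduct_throughMatrix_mulVec, smul_zero]
      · rw [hmul, dotProduct_smul, dotProduct_throughMatrix_mulVec, smul_zero]
      · simp only [hmul]
        by_cases hc : c 3 = 0 ∧ c 1 = 0
        · exact ⟨1, 0, by simp, by simp [hc]⟩
        · refine ⟨c 3, -c 1, ?_, ?_⟩
          · rw [neg_ne_zero]
            tauto
          · rw [smul_smul, smul_smul, ← add_smul]
            ring_nf
            simp

end DegreeFour

theorem isDiscriminant_four {K : Type*} [Field K] (h2 : (2 : K) ≠ 0) (h3 : (3 : K) ≠ 0)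
    (h2' : (2 : AlgebraicClosure K) ≠ 0) (h3' : (3 : AlgebraicClosure K) ≠ 0) :
    IsDiscriminant K 4 (pullback K 4 (weierstrassDisc K)) := by
  have h6912 : (6912 : AlgebraicClosure K) ≠ 0 := by
    rw [show (6912 : AlgebraicClosure K) = 2 ^ 8 * 3 ^ 3 by norm_num]
    positivity
  have h108 : (108 : AlgebraicClosure K) ≠ 0 := by
    rw [show (108 : AlgebraicClosure K) = 2 ^ 2 * 3 ^ 3 by norm_num]
    positivity
  have hsing (φ : Fin 20 → AlgebraicClosure K) : IsSingular 4 φ ↔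
      weierstrassMap₄ K φ 0 ^ 3 - 27 * weierstrassMap₄ K φ 1 ^ 2 = 0 := by
    obtain ⟨A, B, hA, hB, rfl⟩ := exists_matrixPair_eq h2' φ
    refine (isSingular_matrixPair_iff h2' hA hB).trans ?_
    rw [weierstrassMap₄, ← mul_eq_zero_iff_left (b := _ - _) h6912, quarticDisc_eq h2 h3,
      pencilDet_matrixPair h2 hA hB]
    exact ⟨fun ⟨_, h⟩ => quarticDisc_detPencil_eq_zero_of_isPencilNode h2' h3' hA hB h,
      exists_isPencilNode_of_quarticDisc_eq_zero h2' h3' hA hB⟩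
  -- The pencil spanned by `2x₀x₁ + x₂²` and `x₀² + tx₁² + x₂² + x₃²`, with determinant
  -- `det(xA + zB) = z(x + z)(tz² - x²)`.
  let M : Matrix (Fin 4) (Fin 4) (Polynomial (AlgebraicClosure K)) :=
    symMatrix ![0, 0, 1, 0, 1, 0, 0, 0, 0, 0]
  let N : Matrix (Fin 4) (Fin 4) (Polynomial (AlgebraicClosure K)) :=
    symMatrix ![1, Polynomial.X, 1, 1, 0, 0, 0, 0, 0, 0]
  have hdet : pencilDet K (matrixPair M N) = -Polynomial.X ^ 3 - Polynomial.X ^ 2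
      + Polynomial.C Polynomial.X * Polynomial.X + Polynomial.C Polynomial.X := by
    rw [pencilDet_matrixPair h2 (isSymm_symMatrix _) (isSymm_symMatrix _), detPencil]
    simp [symMatrix, Matrix.det_succ_row_zero, Fin.sum_univ_succ, Fin.succAbove]
    ring
  refine isDiscriminant_pullback h2 4 hsing
    (fun i => singularModel₄ X i) (fun φ => ?_)
    (matrixPair M N) (weierstrassMap₄ K _) rfl 6912 h6912
    (108 * (1 - Polynomial.X) ^ 2) (by simpa using h108) ?_
  · obtain ⟨A, B, hA, hB, rfl⟩ := exists_matrixPair_eq h2' φ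
    refine (isSingular_matrixPair_iff h2' hA hB).trans
      ((exists_isPencilNode_iff h2' hA hB).trans (exists_congr fun t => ?_))
    exact forall_congr' fun i => by rw [← eval_singularModel₄]
  · rw [map_ofNat, weierstrassMap₄, hdet]
    refine (quarticDisc_eq h2 h3 _ _ _ _ _).trans ?_
    rw [← quarticDisc_line]
    -- The leading coefficient is `0`, and `quarticDisc` has even degree.
    have hneg (t : Polynomial (AlgebraicClosure K)) :
        quarticDisc 0 1 1 (-t) (-t) = quarticDisc 0 (-1) (-1) t t := by
      rw [quarticDisc, quarticDisc]
      ring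
    rw [hneg]
    simp [Polynomial.coeff_X, Polynomial.coeff_X_pow, Polynomial.coeff_C]

end GenusOne

/-! ### The discriminants of the spaces of genus one models -/

theorem mainTheorem4 (K : Type*) [Field K] (h2 : (2 : K) ≠ 0) (h3 : (3 : K) ≠ 0)
    (n : ℕ) (hn1 : 1 ≤ n) (hn4 : n ≤ 4) :
    (∃ Δ : MvPolynomial (Fin (GenusOne.modelDim n)) K, GenusOne.IsDiscriminant K n Δ) ∧
    ∀ Δ : MvPolynomial (Fin (GenusOne.modelDim n)) K, GenusOne.IsDiscriminant K n Δ →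
      ∃ c : K, c ≠ 0 ∧
        Δ = MvPolynomial.C c * GenusOne.pullback K n (GenusOne.weierstrassDisc K) := by
  have h2' : (2 : AlgebraicClosure K) ≠ 0 := by
    rw [← map_ofNat (algebraMap K (AlgebraicClosure K))]
    exact (map_ne_zero _).mpr h2
  have h3' : (3 : AlgebraicClosure K) ≠ 0 := by
    rw [← map_ofNat (algebraMap K (AlgebraicClosure K))]
    exact (map_ne_zero _).mpr h3
  have h : GenusOne.IsDiscriminant K n (GenusOne.pullback K n (GenusOne.weierstrassDisc K)) := by
    interval_cases n
    · exact GenusOne.isDiscriminant_one h2 h3 h2' h3'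
    · exact GenusOne.isDiscriminant_two h2 h3 h2' h3'
    · exact GenusOne.isDiscriminant_three h2 h3 h2' h3'
    · exact GenusOne.isDiscriminant_four h2 h3 h2' h3'
  exact ⟨⟨_, h⟩, fun Δ hΔ => hΔ.exists_eq_C_mul h⟩
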